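/- Let $G$ be a finite group and $H \leq G$ a subgroup. For a finite group $K$, let $\mathcal{A}^K$ be the Burnside category: its objects are the finite $K$-sets, $\mathcal{A}^K(X,Y)$ is the group completion of the commutative monoid (under disjoint union) of isomorphism classes of spans $X \leftarrow A \to Y$ of finite $K$-sets, and composition is given by pullback. A $K$-Mackey functor is an additive functor $\mathcal{A}^K \to \mathrm{Ab}$; morphisms are natural transformations. The box product $N \boxtimes M$ of two $K$-Mackey functors is the left Kan extension of $(X,Y) \mapsto N(X) \otimes_{\mathbb{Z}} M(Y)$ along the Cartesian product functor $\mathcal{A}^K \times \mathcal{A}^K \to \mathcal{A}^K$, and $M$ is called flat if the functor $- \boxtimes M$ from $K$-Mackey functors to $K$-Mackey functors is exact. For a $G$-Mackey functor $M$, its restriction $i_H^* M$ is the $H$-Mackey functor obtained by precomposing $M$ with the induction functor $G \times_H (-) \colon \mathcal{A}^H \to \mathcal{A}^G$. If $M$ is a flat $G$-Mackey functor, then $i_H^* M$ is a flat $H$-Mackey functor. -/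

import Mathlib

open CategoryTheory CategoryTheory.Limits
open scoped TensorProduct

universe u w

noncomputable section

namespace Equivariant

/-! ### Finite `G`-sets -/

/-- A finite `G`-set. -/
structure FinGSet (G : Type u) [Group G] : Type (u + 1) where
  carrier : Type u
  [action : MulAction G carrier]
  [finite : Finite carrier]

namespace FinGSet

variable {G : Type u} [Group G]

instance : CoeSort (FinGSet G) (Type u) := ⟨FinGSet.carrier⟩

attribute [instance] FinGSet.action FinGSet.finite

/-- The empty `G`-set. -/
def empty (G : Type u) [Group G] : FinGSet G where
  carrier := PEmpty
  action :=
    { smul := fun _ x => x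
      one_smul := fun x => x.elim
      mul_smul := fun _ _ x => x.elim }

/-- Disjoint union of `G`-sets. -/
def sum (X Y : FinGSet G) : FinGSet G where
  carrier := X ⊕ Y

/-- Cartesian product of `G`-sets, with the diagonal action. -/
def prod (X Y : FinGSet G) : FinGSet G where
  carrier := X × Y

/-- The fibre product of `f : X → Z` and `g : Y → Z`, with the diagonal action. -/
def pullback {X Y Z : FinGSet G} (f : X →[G] Z) (g : Y →[G] Z) : FinGSet G where
  carrier := {p : X × Y // f p.1 = g p.2}
  action :=
    { smul := fun a p => ⟨(a • p.1.1, a • p.1.2), by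
        rw [map_smul, map_smul, p.2]⟩
      one_smul := fun p => Subtype.ext (Prod.ext (one_smul _ _) (one_smul _ _))
      mul_smul := fun a b p => Subtype.ext (Prod.ext (mul_smul _ _ _) (mul_smul _ _ _)) }
  finite := Subtype.finite

end FinGSet

/-! ### Spans -/

variable {G : Type u} [Group G]

/-- A span `X ← A → Y` of finite `G`-sets. -/
structure GSpan (X Y : FinGSet G) : Type (u + 1) where
  apex : FinGSet G
  left : apex →[G] X
  right : apex →[G] Y

namespace GSpan

variable {X Y Z W : FinGSet G}

/-- Isomorphism of spans: an equivariant bijection of the apices over `X` and `Y`. -/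
def Rel (S T : GSpan X Y) : Prop :=
  ∃ e : S.apex ≃ T.apex, (∀ (g : G) (a : S.apex), e (g • a) = g • e a) ∧
    (∀ a, T.left (e a) = S.left a) ∧ (∀ a, T.right (e a) = S.right a)

instance setoid (X Y : FinGSet G) : Setoid (GSpan X Y) where
  r := Rel
  iseqv :=
    { refl := fun S => ⟨Equiv.refl _, fun _ _ => rfl, fun _ => rfl, fun _ => rfl⟩
      symm := by
        rintro S T ⟨e, h1, h2, h3⟩
        refine ⟨e.symm, fun g a => ?_, fun a => ?_, fun a => ?_⟩
        · apply e.injective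
          rw [h1]; simp
        · rw [← h2]; simp
        · rw [← h3]; simp
      trans := by
        rintro S T U ⟨e, h1, h2, h3⟩ ⟨e', h1', h2', h3'⟩
        refine ⟨e.trans e', fun g a => ?_, fun a => ?_, fun a => ?_⟩
        · simp [h1, h1']
        · simp [h2, h2']
        · simp [h3, h3'] }

/-- The identity span. -/
def id (X : FinGSet G) : GSpan X X where
  apex := X
  left := MulActionHom.id G
  right := MulActionHom.id G

/-- The empty span. -/
def zero (X Y : FinGSet G) : GSpan X Y where
  apex := FinGSet.empty G
  left := { toFun := fun x => PEmpty.elim x, map_smul' := fun _ x => PEmpty.elim x }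
  right := { toFun := fun x => PEmpty.elim x, map_smul' := fun _ x => PEmpty.elim x }

/-- Disjoint union of spans. -/
def add (S T : GSpan X Y) : GSpan X Y where
  apex := S.apex.sum T.apex
  left :=
    { toFun := fun x => Sum.elim S.left T.left x
      map_smul' := by
        rintro g (a | a)
        · exact map_smul S.left g a
        · exact map_smul T.left g a }
  right :=
    { toFun := fun x => Sum.elim S.right T.right x
      map_smul' := by
        rintro g (a | a)
        · exact map_smul S.right g a
        · exact map_smul T.right g a }

/-- Composition of spans, by fibre product over the middle `G`-set. -/
def comp (S : GSpan X Y) (T : GSpan Y Z) : GSpan X Z where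
  apex := FinGSet.pullback S.right T.left
  left :=
    { toFun := fun p => S.left p.1.1
      map_smul' := fun g p => map_smul S.left g p.1.1 }
  right :=
    { toFun := fun p => T.right p.1.2
      map_smul' := fun g p => map_smul T.right g p.1.2 }

/-- Cartesian product of spans. -/
def prod (S : GSpan X Y) (T : GSpan Z W) : GSpan (X.prod Z) (Y.prod W) where
  apex := S.apex.prod T.apex
  left :=
    { toFun := fun p => (S.left p.1, T.left p.2)
      map_smul' := fun g p => Prod.ext (map_smul S.left g p.1) (map_smul T.left g p.2) }
  right :=
    { toFun := fun p => (S.right p.1, T.right p.2)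
      map_smul' := fun g p => Prod.ext (map_smul S.right g p.1) (map_smul T.right g p.2) }

end GSpan

/-- Isomorphism classes of spans from `X` to `Y`. -/
def SpanClass (X Y : FinGSet G) : Type (u + 1) := Quotient (GSpan.setoid X Y)

namespace SpanClass

variable {X Y Z W X' Y' Z' : FinGSet G}

/-- The class of a span. -/
def mk (S : GSpan X Y) : SpanClass X Y := Quotient.mk _ S

theorem ind {p : SpanClass X Y → Prop} (h : ∀ S, p (mk S)) (x : SpanClass X Y) : p x :=
  Quotient.ind h x

theorem sound {S T : GSpan X Y} (e : S.apex ≃ T.apex)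
    (h1 : ∀ (g : G) (a : S.apex), e (g • a) = g • e a)
    (h2 : ∀ a, T.left (e a) = S.left a) (h3 : ∀ a, T.right (e a) = S.right a) :
    mk S = mk T :=
  Quotient.sound ⟨e, h1, h2, h3⟩

instance : Zero (SpanClass X Y) := ⟨mk (GSpan.zero X Y)⟩

instance : Add (SpanClass X Y) :=
  ⟨Quotient.map₂ GSpan.add (by
    rintro S S' ⟨e, h1, h2, h3⟩ T T' ⟨e', h1', h2', h3'⟩
    refine ⟨Equiv.sumCongr e e', ?_, ?_, ?_⟩
    · rintro g (a | a)
      · exact congrArg Sum.inl (h1 g a)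
      · exact congrArg Sum.inr (h1' g a)
    · rintro (a | a)
      · exact h2 a
      · exact h2' a
    · rintro (a | a)
      · exact h3 a
      · exact h3' a)⟩

theorem mk_add (S T : GSpan X Y) : mk S + mk T = mk (S.add T) := rfl

theorem zero_def : (0 : SpanClass X Y) = mk (GSpan.zero X Y) := rfl

protected theorem add_comm' (a b : SpanClass X Y) : a + b = b + a := by
  induction a using ind with | _ S
  induction b using ind with | _ T
  refine sound (Equiv.sumComm _ _) ?_ ?_ ?_
  · rintro g (a | a) <;> rfl
  · rintro (a | a) <;> rfl
  · rintro (a | a) <;> rfl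

protected theorem zero_add' (a : SpanClass X Y) : 0 + a = a := by
  induction a using ind with | _ S
  refine sound (Equiv.emptySum PEmpty S.apex) ?_ ?_ ?_
  · rintro g (a | a)
    · exact a.elim
    · rfl
  · rintro (a | a)
    · exact a.elim
    · rfl
  · rintro (a | a)
    · exact a.elim
    · rfl

/-- The monoid structure given by disjoint union. -/
instance : AddCommMonoid (SpanClass X Y) where
  add_assoc a b c := by
    induction a using ind with | _ S
    induction b using ind with | _ T
    induction c using ind with | _ U
    refine sound (Equiv.sumAssoc _ _ _) ?_ ?_ ?_
    · rintro g ((a | a) | a) <;> rfl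
    · rintro ((a | a) | a) <;> rfl
    · rintro ((a | a) | a) <;> rfl
  zero_add := SpanClass.zero_add'
  add_zero a := by rw [SpanClass.add_comm', SpanClass.zero_add']
  add_comm := SpanClass.add_comm'
  nsmul := nsmulRec


/-- Composition of classes of spans, as a biadditive map. -/
def comp : SpanClass X Y →+ SpanClass Y Z →+ SpanClass X Z where
  toFun a :=
    { toFun := fun b => Quotient.map₂ GSpan.comp (by
        rintro S S' ⟨e, h1, h2, h3⟩ T T' ⟨e', h1', h2', h3'⟩
        refine ⟨Equiv.subtypeEquiv (Equiv.prodCongr e e') ?_, ?_, ?_, ?_⟩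
        · rintro ⟨x, y⟩
          simp [h3, h2']
        · rintro g ⟨⟨x, y⟩, h⟩
          exact Subtype.ext (Prod.ext (h1 g x) (h1' g y))
        · rintro ⟨⟨x, y⟩, h⟩
          exact h2 x
        · rintro ⟨⟨x, y⟩, h⟩
          exact h3' y) a b
      map_zero' := by
        induction a using ind with | _ S
        refine sound
          { toFun := fun p => p.1.2, invFun := fun p => p.elim,
            left_inv := fun p => p.1.2.elim, right_inv := fun p => p.elim } ?_ ?_ ?_
        · intro g p; exact p.1.2.elim
        · intro p; exact p.1.2.elim
        · intro p; exact p.1.2.elim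
      map_add' := fun b c => by
        induction a using ind with | _ S
        induction b using ind with | _ T
        induction c using ind with | _ U
        refine sound
          { toFun := fun p => match p with
              | ⟨(x, Sum.inl y), h⟩ => Sum.inl ⟨(x, y), h⟩
              | ⟨(x, Sum.inr y), h⟩ => Sum.inr ⟨(x, y), h⟩
            invFun := fun p => match p with
              | Sum.inl p => ⟨(p.1.1, Sum.inl p.1.2), p.2⟩
              | Sum.inr p => ⟨(p.1.1, Sum.inr p.1.2), p.2⟩
            left_inv := by rintro ⟨⟨x, y | y⟩, h⟩ <;> rfl
            right_inv := by rintro (p | p) <;> rfl } ?_ ?_ ?_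
        · rintro g ⟨⟨x, y | y⟩, h⟩ <;> rfl
        · rintro ⟨⟨x, y | y⟩, h⟩ <;> rfl
        · rintro ⟨⟨x, y | y⟩, h⟩ <;> rfl }
  map_zero' := by
    ext b
    induction b using ind with | _ S
    refine sound
      { toFun := fun p => p.1.1, invFun := fun p => p.elim,
        left_inv := fun p => p.1.1.elim, right_inv := fun p => p.elim } ?_ ?_ ?_
    · intro g p; exact p.1.1.elim
    · intro p; exact p.1.1.elim
    · intro p; exact p.1.1.elim
  map_add' a b := by
    ext c
    induction a using ind with | _ S
    induction b using ind with | _ T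
    induction c using ind with | _ U
    refine sound
      { toFun := fun p => match p with
          | ⟨(Sum.inl x, y), h⟩ => Sum.inl ⟨(x, y), h⟩
          | ⟨(Sum.inr x, y), h⟩ => Sum.inr ⟨(x, y), h⟩
        invFun := fun p => match p with
          | Sum.inl p => ⟨(Sum.inl p.1.1, p.1.2), p.2⟩
          | Sum.inr p => ⟨(Sum.inr p.1.1, p.1.2), p.2⟩
        left_inv := by rintro ⟨⟨x | x, y⟩, h⟩ <;> rfl
        right_inv := by rintro (p | p) <;> rfl } ?_ ?_ ?_
    · rintro g ⟨⟨x | x, y⟩, h⟩ <;> rfl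
    · rintro ⟨⟨x | x, y⟩, h⟩ <;> rfl
    · rintro ⟨⟨x | x, y⟩, h⟩ <;> rfl

theorem comp_mk (S : GSpan X Y) (T : GSpan Y Z) : comp (mk S) (mk T) = mk (S.comp T) := rfl

theorem id_comp (a : SpanClass X Y) : comp (mk (GSpan.id X)) a = a := by
  induction a using ind with | _ S
  refine sound
    { toFun := fun p => p.1.2, invFun := fun x => ⟨(S.left x, x), rfl⟩,
      left_inv := ?_, right_inv := fun _ => rfl } ?_ ?_ ?_
  · rintro ⟨⟨x, y⟩, h⟩
    exact Subtype.ext (Prod.ext (Eq.symm h) rfl)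
  · rintro g ⟨⟨x, y⟩, h⟩; rfl
  · rintro ⟨⟨x, y⟩, h⟩; exact Eq.symm h
  · rintro ⟨⟨x, y⟩, h⟩; rfl

theorem comp_id (a : SpanClass X Y) : comp a (mk (GSpan.id Y)) = a := by
  induction a using ind with | _ S
  refine sound
    { toFun := fun p => p.1.1, invFun := fun x => ⟨(x, S.right x), rfl⟩,
      left_inv := ?_, right_inv := fun _ => rfl } ?_ ?_ ?_
  · rintro ⟨⟨x, y⟩, h⟩
    exact Subtype.ext (Prod.ext rfl h)
  · rintro g ⟨⟨x, y⟩, h⟩; rfl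
  · rintro ⟨⟨x, y⟩, h⟩; rfl
  · rintro ⟨⟨x, y⟩, h⟩; exact h

theorem comp_assoc (a : SpanClass X Y) (b : SpanClass Y Z) (c : SpanClass Z W) :
    comp (comp a b) c = comp a (comp b c) := by
  induction a using ind with | _ S
  induction b using ind with | _ T
  induction c using ind with | _ U
  refine sound
    { toFun := fun p => ⟨(p.1.1.1.1, ⟨(p.1.1.1.2, p.1.2), p.2⟩), p.1.1.2⟩
      invFun := fun p => ⟨(⟨(p.1.1, p.1.2.1.1), p.2⟩, p.1.2.1.2), p.1.2.2⟩
      left_inv := fun _ => rfl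
      right_inv := fun _ => rfl } ?_ ?_ ?_
  · intro g p; rfl
  · intro p; rfl
  · intro p; rfl

/-- Cartesian product of classes of spans, as a biadditive map. -/
def prod : SpanClass X Y →+ SpanClass Z W →+ SpanClass (X.prod Z) (Y.prod W) where
  toFun a :=
    { toFun := fun b => Quotient.map₂ GSpan.prod (by
        rintro S S' ⟨e, h1, h2, h3⟩ T T' ⟨e', h1', h2', h3'⟩
        refine ⟨Equiv.prodCongr e e', ?_, ?_, ?_⟩
        · rintro g ⟨x, y⟩
          exact Prod.ext (h1 g x) (h1' g y)
        · rintro ⟨x, y⟩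
          exact Prod.ext (h2 x) (h2' y)
        · rintro ⟨x, y⟩
          exact Prod.ext (h3 x) (h3' y)) a b
      map_zero' := by
        induction a using ind with | _ S
        refine sound
          { toFun := fun p => p.2, invFun := fun p => p.elim,
            left_inv := fun p => p.2.elim, right_inv := fun p => p.elim } ?_ ?_ ?_
        · intro g p; exact p.2.elim
        · intro p; exact p.2.elim
        · intro p; exact p.2.elim
      map_add' := fun b c => by
        induction a using ind with | _ S
        induction b using ind with | _ T
        induction c using ind with | _ U
        refine sound (Equiv.prodSumDistrib _ _ _) ?_ ?_ ?_
        · rintro g ⟨x, y | y⟩ <;> rfl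
        · rintro ⟨x, y | y⟩ <;> rfl
        · rintro ⟨x, y | y⟩ <;> rfl }
  map_zero' := by
    ext b
    induction b using ind with | _ S
    refine sound
      { toFun := fun p => p.1, invFun := fun p => p.elim,
        left_inv := fun p => p.1.elim, right_inv := fun p => p.elim } ?_ ?_ ?_
    · intro g p; exact p.1.elim
    · intro p; exact p.1.elim
    · intro p; exact p.1.elim
  map_add' a b := by
    ext c
    induction a using ind with | _ S
    induction b using ind with | _ T
    induction c using ind with | _ U
    refine sound (Equiv.sumProdDistrib _ _ _) ?_ ?_ ?_
    · rintro g ⟨x | x, y⟩ <;> rfl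
    · rintro ⟨x | x, y⟩ <;> rfl
    · rintro ⟨x | x, y⟩ <;> rfl

theorem prod_mk (S : GSpan X Y) (T : GSpan Z W) : prod (mk S) (mk T) = mk (S.prod T) := rfl

theorem prod_id : prod (mk (GSpan.id X)) (mk (GSpan.id Y)) = mk (GSpan.id (X.prod Y)) := rfl

theorem prod_comp (a : SpanClass X Y) (b : SpanClass Y Z) (a' : SpanClass X' Y')
    (b' : SpanClass Y' Z') :
    prod (comp a b) (comp a' b') = comp (prod a a') (prod b b') := by
  induction a using ind with | _ S
  induction b using ind with | _ T
  induction a' using ind with | _ S'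
  induction b' using ind with | _ T'
  refine sound
    { toFun := fun p => ⟨((p.1.1.1, p.2.1.1), (p.1.1.2, p.2.1.2)), Prod.ext p.1.2 p.2.2⟩
      invFun := fun p => (⟨(p.1.1.1, p.1.2.1), congrArg Prod.fst p.2⟩,
        ⟨(p.1.1.2, p.1.2.2), congrArg Prod.snd p.2⟩)
      left_inv := fun _ => rfl
      right_inv := fun _ => rfl } ?_ ?_ ?_
  · intro g p; rfl
  · intro p; rfl
  · intro p; rfl

end SpanClass

/-! ### Group completion -/

open Algebra

theorem lift_of {A B : Type*} [AddCommMonoid A] [AddCommGroup B] (f : A →+ B) (a : A) :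
    GrothendieckAddGroup.lift f (GrothendieckAddGroup.of a) = f a :=
  DFunLike.congr_fun (GrothendieckAddGroup.lift.symm_apply_apply f) a

theorem groth_hom_ext {A B : Type*} [AddCommMonoid A] [AddCommGroup B]
    {f g : GrothendieckAddGroup A →+ B}
    (h : ∀ a : A, f (GrothendieckAddGroup.of a) = g (GrothendieckAddGroup.of a)) : f = g :=
  GrothendieckAddGroup.lift.symm.injective (AddMonoidHom.ext h)

/-- Every element of the group completion is a difference of elements of the monoid. -/
theorem groth_ind {A : Type*} [AddCommMonoid A] {p : GrothendieckAddGroup A → Prop}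
    (of : ∀ a : A, p (GrothendieckAddGroup.of a)) (sub : ∀ x y, p x → p y → p (x - y))
    (x : GrothendieckAddGroup A) : p x := by
  induction x using AddLocalization.ind with | _ y
  obtain ⟨a, b⟩ := y
  have h := sub _ _ (of a) (of b.1)
  have e : (GrothendieckAddGroup.of a : GrothendieckAddGroup A) - GrothendieckAddGroup.of b.1 =
      AddLocalization.mk a b := by
    change (AddLocalization.addMonoidOf ⊤) a - (AddLocalization.addMonoidOf ⊤) b.1 = _
    rw [← AddLocalization.mk_zero_eq_addMonoidOf_mk, ← AddLocalization.mk_zero_eq_addMonoidOf_mk,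
      GrothendieckAddGroup.mk_sub_mk]
    simp
  rw [← e]
  exact h

/-- A biadditive map of commutative monoids extends to the group completions. -/
def lift₂ {A B C : Type*} [AddCommMonoid A] [AddCommMonoid B] [AddCommMonoid C]
    (f : A →+ B →+ C) :
    GrothendieckAddGroup A →+ GrothendieckAddGroup B →+ GrothendieckAddGroup C :=
  GrothendieckAddGroup.lift
    { toFun := fun a => GrothendieckAddGroup.lift (GrothendieckAddGroup.of.comp (f a))
      map_zero' := groth_hom_ext fun b => by
        rw [lift_of, AddMonoidHom.comp_apply, map_zero, AddMonoidHom.zero_apply,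
          AddMonoidHom.zero_apply, map_zero]
      map_add' := fun a a' => groth_hom_ext fun b => by
        rw [AddMonoidHom.add_apply, lift_of, lift_of, lift_of, AddMonoidHom.comp_apply, map_add,
          AddMonoidHom.add_apply, map_add, AddMonoidHom.comp_apply, AddMonoidHom.comp_apply] }

theorem lift₂_of {A B C : Type*} [AddCommMonoid A] [AddCommMonoid B] [AddCommMonoid C]
    (f : A →+ B →+ C) (a : A) (b : B) :
    lift₂ f (GrothendieckAddGroup.of a) (GrothendieckAddGroup.of b) =
      GrothendieckAddGroup.of (f a b) := by
  unfold lift₂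
  rw [lift_of]
  exact lift_of _ b

/-! ### The Burnside category -/

/-- The Burnside category of `G`: its objects are the finite `G`-sets, and its morphisms `X ⟶ Y`
are the elements of the group completion of the monoid of isomorphism classes of spans. -/
structure BurnsideCat (G : Type u) [Group G] : Type (u + 1) where
  of ::
  set : FinGSet G

namespace BurnsideCat

instance : Category.{u + 1} (BurnsideCat G) where
  Hom X Y := GrothendieckAddGroup (SpanClass X.set Y.set)
  id X := GrothendieckAddGroup.of (SpanClass.mk (GSpan.id X.set))
  comp f g := lift₂ SpanClass.comp f g
  id_comp {X Y} f := by
    induction f using groth_ind with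
    | of a => rw [lift₂_of, SpanClass.id_comp]
    | sub x y hx hy => rw [map_sub, hx, hy]
  comp_id {X Y} f := by
    induction f using groth_ind with
    | of a => rw [lift₂_of, SpanClass.comp_id]
    | sub x y hx hy => rw [map_sub, AddMonoidHom.sub_apply, hx, hy]
  assoc {X Y Z W} f g h := by
    induction f using groth_ind with
    | of a =>
      induction g using groth_ind with
      | of b =>
        induction h using groth_ind with
        | of c => rw [lift₂_of, lift₂_of, lift₂_of, lift₂_of, SpanClass.comp_assoc]
        | sub x y hx hy => simp only [map_sub, hx, hy]
      | sub x y hx hy => simp only [map_sub, AddMonoidHom.sub_apply, hx, hy]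
    | sub x y hx hy => simp only [map_sub, AddMonoidHom.sub_apply, hx, hy]

/-- The morphism given by a span. -/
def ofSpan {X Y : FinGSet G} (S : GSpan X Y) : of X ⟶ of Y :=
  GrothendieckAddGroup.of (SpanClass.mk S)

instance : Preadditive (BurnsideCat G) where
  homGroup X Y := inferInstanceAs (AddCommGroup (GrothendieckAddGroup (SpanClass X.set Y.set)))
  add_comp X Y Z f f' g := DFunLike.congr_fun
    ((lift₂ (SpanClass.comp (X := X.set) (Y := Y.set) (Z := Z.set))).map_add f f') g
  comp_add X Y Z f g g' :=
    (lift₂ (SpanClass.comp (X := X.set) (Y := Y.set) (Z := Z.set)) f).map_add g g'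

/-- Every morphism is a difference of spans. -/
theorem hom_ind {X Y : BurnsideCat G} {p : (X ⟶ Y) → Prop}
    (ofSpan : ∀ S : GSpan X.set Y.set, p (ofSpan S)) (sub : ∀ f g, p f → p g → p (f - g))
    (f : X ⟶ Y) : p f :=
  groth_ind (fun a => SpanClass.ind (p := fun a => p (GrothendieckAddGroup.of a)) ofSpan a) sub f

theorem ofSpan_comp {X Y Z : FinGSet G} (S : GSpan X Y) (T : GSpan Y Z) :
    ofSpan S ≫ ofSpan T = ofSpan (S.comp T) :=
  lift₂_of _ _ _

theorem ofSpan_id (X : FinGSet G) : ofSpan (GSpan.id X) = 𝟙 (of X) := rfl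

theorem ofSpan_zero (X Y : FinGSet G) : ofSpan (GSpan.zero X Y) = 0 :=
  map_zero (GrothendieckAddGroup.of (M := SpanClass X Y))

theorem ofSpan_eq {X Y : FinGSet G} {S T : GSpan X Y} (e : S.apex ≃ T.apex)
    (h1 : ∀ (g : G) (a : S.apex), e (g • a) = g • e a)
    (h2 : ∀ a, T.left (e a) = S.left a) (h3 : ∀ a, T.right (e a) = S.right a) :
    ofSpan S = ofSpan T :=
  congrArg (fun a => GrothendieckAddGroup.of a) (SpanClass.sound e h1 h2 h3)

/-- The cartesian product of `G`-sets, as a functor `(X, Y) ↦ X × Y` on the Burnside category. -/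
def times (G : Type u) [Group G] : BurnsideCat G × BurnsideCat G ⥤ BurnsideCat G where
  obj P := of (P.1.set.prod P.2.set)
  map f := lift₂ SpanClass.prod f.1 f.2
  map_id P := by
    change lift₂ SpanClass.prod (GrothendieckAddGroup.of _) (GrothendieckAddGroup.of _) = _
    rw [lift₂_of, SpanClass.prod_id]; rfl
  map_comp {P Q R} f g := by
    obtain ⟨f, f'⟩ := f
    obtain ⟨g, g'⟩ := g
    change lift₂ SpanClass.prod (lift₂ SpanClass.comp f g) (lift₂ SpanClass.comp f' g') =
      lift₂ SpanClass.comp (lift₂ SpanClass.prod f f') (lift₂ SpanClass.prod g g')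
    induction f using groth_ind with
    | of a =>
      induction f' using groth_ind with
      | of a' =>
        induction g using groth_ind with
        | of b =>
          induction g' using groth_ind with
          | of b' => simp only [lift₂_of, SpanClass.prod_comp]
          | sub x y hx hy => simp only [map_sub, hx, hy]
        | sub x y hx hy => simp only [map_sub, AddMonoidHom.sub_apply, hx, hy]
      | sub x y hx hy => simp only [map_sub, AddMonoidHom.sub_apply, hx, hy]
    | sub x y hx hy => simp only [map_sub, AddMonoidHom.sub_apply, hx, hy]

theorem times_map_add {X Y Z W : BurnsideCat G} (f : X ⟶ Y) (g g' : Z ⟶ W) :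
    (times G).map (X := (X, Z)) (Y := (Y, W)) (f, g + g') =
      (times G).map (X := (X, Z)) (Y := (Y, W)) (f, g) +
        (times G).map (X := (X, Z)) (Y := (Y, W)) (f, g') :=
  map_add (lift₂ SpanClass.prod f) g g'

theorem times_map_zero {X Y Z W : BurnsideCat G} (f : X ⟶ Y) :
    (times G).map (X := (X, Z)) (Y := (Y, W)) (f, 0) = 0 :=
  map_zero (lift₂ SpanClass.prod f)

/-! Disjoint unions are biproducts in the Burnside category. -/

/-- The inclusion of the first summand. -/
def spanInl (X Y : FinGSet G) : GSpan X (X.sum Y) where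
  apex := X
  left := MulActionHom.id G
  right := { toFun := fun x => Sum.inl x, map_smul' := fun _ _ => rfl }

/-- The inclusion of the second summand. -/
def spanInr (X Y : FinGSet G) : GSpan Y (X.sum Y) where
  apex := Y
  left := MulActionHom.id G
  right := { toFun := fun x => Sum.inr x, map_smul' := fun _ _ => rfl }

/-- The projection to the first summand. -/
def spanFst (X Y : FinGSet G) : GSpan (X.sum Y) X where
  apex := X
  left := { toFun := fun x => Sum.inl x, map_smul' := fun _ _ => rfl }
  right := MulActionHom.id G

/-- The projection to the second summand. -/
def spanSnd (X Y : FinGSet G) : GSpan (X.sum Y) Y where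
  apex := Y
  left := { toFun := fun x => Sum.inr x, map_smul' := fun _ _ => rfl }
  right := MulActionHom.id G

theorem inl_fst (X Y : FinGSet G) : ofSpan (spanInl X Y) ≫ ofSpan (spanFst X Y) = 𝟙 _ := by
  rw [ofSpan_comp, ← ofSpan_id]
  refine ofSpan_eq
    { toFun := fun p => p.1.1, invFun := fun x => ⟨(x, x), rfl⟩
      left_inv := ?_, right_inv := fun _ => rfl } ?_ ?_ ?_
  · rintro ⟨⟨x, y⟩, h⟩
    exact Subtype.ext (Prod.ext rfl (Sum.inl.inj h))
  · intro g p; rfl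
  · intro p; rfl
  · rintro ⟨⟨x, y⟩, h⟩
    exact Sum.inl.inj h

theorem inr_snd (X Y : FinGSet G) : ofSpan (spanInr X Y) ≫ ofSpan (spanSnd X Y) = 𝟙 _ := by
  rw [ofSpan_comp, ← ofSpan_id]
  refine ofSpan_eq
    { toFun := fun p => p.1.1, invFun := fun x => ⟨(x, x), rfl⟩
      left_inv := ?_, right_inv := fun _ => rfl } ?_ ?_ ?_
  · rintro ⟨⟨x, y⟩, h⟩
    exact Subtype.ext (Prod.ext rfl (Sum.inr.inj h))
  · intro g p; rfl
  · intro p; rfl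
  · rintro ⟨⟨x, y⟩, h⟩
    exact Sum.inr.inj h

theorem inl_snd (X Y : FinGSet G) : ofSpan (spanInl X Y) ≫ ofSpan (spanSnd X Y) = 0 := by
  rw [ofSpan_comp, ← ofSpan_zero]
  have key : ∀ p : ((spanInl X Y).comp (spanSnd X Y)).apex, False := by
    rintro ⟨⟨x, y⟩, h⟩
    exact Sum.inl_ne_inr h
  exact ofSpan_eq
    { toFun := fun p => (key p).elim, invFun := fun x => PEmpty.elim x
      left_inv := fun p => (key p).elim, right_inv := fun x => PEmpty.elim x }
    (fun g p => (key p).elim) (fun p => (key p).elim) (fun p => (key p).elim)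

theorem inr_fst (X Y : FinGSet G) : ofSpan (spanInr X Y) ≫ ofSpan (spanFst X Y) = 0 := by
  rw [ofSpan_comp, ← ofSpan_zero]
  have key : ∀ p : ((spanInr X Y).comp (spanFst X Y)).apex, False := by
    rintro ⟨⟨x, y⟩, h⟩
    exact Sum.inr_ne_inl h
  exact ofSpan_eq
    { toFun := fun p => (key p).elim, invFun := fun x => PEmpty.elim x
      left_inv := fun p => (key p).elim, right_inv := fun x => PEmpty.elim x }
    (fun g p => (key p).elim) (fun p => (key p).elim) (fun p => (key p).elim)

end BurnsideCat

/-! ### Induction of finite `H`-sets -/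

section Induction

variable [Finite G] (H : Subgroup G)

/-- The relation `(a h, x) ∼ (a, h x)` on `G × X`. -/
def indSetoid (X : FinGSet H) : Setoid (G × X) where
  r p q := ∃ h : H, p.1 = q.1 * h ∧ q.2 = h • p.2
  iseqv :=
    { refl := fun p => ⟨1, by simp⟩
      symm := by
        rintro ⟨a, x⟩ ⟨b, y⟩ ⟨h, h1, h2⟩
        refine ⟨h⁻¹, ?_, ?_⟩
        · simp_all
        · simp_all
      trans := by
        rintro ⟨a, x⟩ ⟨b, y⟩ ⟨c, z⟩ ⟨h, h1, h2⟩ ⟨k, k1, k2⟩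
        refine ⟨k * h, ?_, ?_⟩
        · simp_all [mul_assoc]
        · simp_all [mul_smul] }

/-- The induced `G`-set `G ×_H X`. -/
def ind (X : FinGSet H) : FinGSet G where
  carrier := Quotient (indSetoid H X)
  action :=
    { smul := fun g => Quotient.map (fun p => (g * p.1, p.2)) (by
        rintro ⟨a, x⟩ ⟨b, y⟩ ⟨h, h1, h2⟩
        refine ⟨h, ?_, h2⟩
        change g * a = g * b * h
        rw [mul_assoc]; exact congrArg _ h1)
      one_smul := by
        rintro ⟨a, x⟩
        exact congrArg (Quotient.mk _) (Prod.ext (one_mul a) rfl)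
      mul_smul := by
        rintro g g' ⟨a, x⟩
        exact congrArg (Quotient.mk _) (Prod.ext (mul_assoc g g' a) rfl) }
  finite := Quotient.finite _

variable {H}

/-- The class of `(a, x)` in `G ×_H X`. -/
def indMk {X : FinGSet H} (a : G) (x : X) : ind H X := Quotient.mk (indSetoid H X) (a, x)

theorem indMk_eq {X : FinGSet H} {a b : G} {x y : X} :
    indMk a x = indMk b y ↔ ∃ h : H, a = b * h ∧ y = h • x :=
  ⟨fun e => Quotient.exact e, fun e => Quotient.sound (s := indSetoid H X) e⟩

theorem ind_rec {X : FinGSet H} {p : ind H X → Prop} (h : ∀ a x, p (indMk a x)) (z : ind H X) :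
    p z :=
  Quotient.ind (fun q => h q.1 q.2) z

theorem smul_indMk {X : FinGSet H} (g a : G) (x : X) : g • indMk a x = indMk (g * a) x := rfl

/-- `G ×_H f`. -/
def indMap {X Y : FinGSet H} (f : X →[H] Y) : ind H X →[G] ind H Y where
  toFun := Quotient.map (fun p => (p.1, f p.2)) (by
    rintro ⟨a, x⟩ ⟨b, y⟩ ⟨h, h1, h2⟩
    exact ⟨h, h1, (congrArg f h2).trans (map_smul f h x)⟩)
  map_smul' g := by
    rintro ⟨a, x⟩
    rfl

theorem indMap_mk {X Y : FinGSet H} (f : X →[H] Y) (a : G) (x : X) :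
    indMap f (indMk a x) = indMk a (f x) := rfl

/-- `G ×_H (-)` applied to a span. -/
def indSpan {X Y : FinGSet H} (S : GSpan X Y) : GSpan (ind H X) (ind H Y) where
  apex := ind H S.apex
  left := indMap S.left
  right := indMap S.right

/-- `G ×_H (-)` on classes of spans. -/
def indClass {X Y : FinGSet H} : SpanClass X Y →+ SpanClass (ind H X) (ind H Y) where
  toFun := Quotient.map indSpan (by
    rintro S T ⟨e, h1, h2, h3⟩
    let i : S.apex →[H] T.apex := { toFun := e, map_smul' := h1 }
    let j : T.apex →[H] S.apex :=
      { toFun := e.symm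
        map_smul' := fun h x => e.injective (by rw [h1]; simp) }
    refine ⟨{ toFun := indMap i, invFun := indMap j, left_inv := ?_, right_inv := ?_ },
      ?_, ?_, ?_⟩
    · intro z
      induction z using ind_rec with | _ a x
      exact congrArg (indMk a) (e.symm_apply_apply x)
    · intro z
      induction z using ind_rec with | _ a x
      exact congrArg (indMk a) (e.apply_symm_apply x)
    · intro g z
      exact map_smul (indMap i) g z
    · intro z
      induction z using ind_rec with | _ a x
      exact congrArg (indMk a) (h2 x)
    · intro z
      induction z using ind_rec with | _ a x
      exact congrArg (indMk a) (h3 x))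
  map_zero' := by
    have key : ∀ p : ind H (FinGSet.empty H), False := by
      intro p
      induction p using ind_rec with | _ a x
      exact PEmpty.elim x
    exact SpanClass.sound
      { toFun := fun p => (key p).elim, invFun := fun x => PEmpty.elim x
        left_inv := fun p => (key p).elim, right_inv := fun x => PEmpty.elim x }
      (fun g p => (key p).elim) (fun p => (key p).elim) (fun p => (key p).elim)
  map_add' a b := by
    induction a using SpanClass.ind with | _ S
    induction b using SpanClass.ind with | _ T
    let i : S.apex →[H] S.apex.sum T.apex :=
      { toFun := fun x => Sum.inl x, map_smul' := fun _ _ => rfl }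
    let j : T.apex →[H] S.apex.sum T.apex :=
      { toFun := fun x => Sum.inr x, map_smul' := fun _ _ => rfl }
    symm
    refine SpanClass.sound (Equiv.ofBijective (Sum.elim (indMap i) (indMap j)) ⟨?_, ?_⟩) ?_ ?_ ?_
    · rintro (p | p) (q | q) hpq
      · induction p using ind_rec with | _ a x
        induction q using ind_rec with | _ b y
        obtain ⟨h, h1, h2⟩ := indMk_eq.1 hpq
        exact congrArg Sum.inl (indMk_eq.2 ⟨h, h1, Sum.inl.inj h2⟩)
      · induction p using ind_rec with | _ a x
        induction q using ind_rec with | _ b y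
        obtain ⟨h, h1, h2⟩ := indMk_eq.1 hpq
        exact (Sum.inr_ne_inl h2).elim
      · induction p using ind_rec with | _ a x
        induction q using ind_rec with | _ b y
        obtain ⟨h, h1, h2⟩ := indMk_eq.1 hpq
        exact (Sum.inl_ne_inr h2).elim
      · induction p using ind_rec with | _ a x
        induction q using ind_rec with | _ b y
        obtain ⟨h, h1, h2⟩ := indMk_eq.1 hpq
        exact congrArg Sum.inr (indMk_eq.2 ⟨h, h1, Sum.inr.inj h2⟩)
    · intro p
      induction p using ind_rec with | _ a x
      obtain x | x := x
      · exact ⟨Sum.inl (indMk a x), rfl⟩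
      · exact ⟨Sum.inr (indMk a x), rfl⟩
    · rintro g (p | p)
      · exact map_smul (indMap i) g p
      · exact map_smul (indMap j) g p
    · rintro (p | p)
      · induction p using ind_rec with | _ a x
        rfl
      · induction p using ind_rec with | _ a x
        rfl
    · rintro (p | p)
      · induction p using ind_rec with | _ a x
        rfl
      · induction p using ind_rec with | _ a x
        rfl

theorem indClass_mk {X Y : FinGSet H} (S : GSpan X Y) :
    indClass (SpanClass.mk S) = SpanClass.mk (indSpan S) := rfl

theorem indClass_id (X : FinGSet H) :
    indClass (SpanClass.mk (GSpan.id X)) = SpanClass.mk (GSpan.id (ind H X)) := by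
  refine SpanClass.sound (Equiv.refl _) (fun _ _ => rfl) ?_ ?_
  · intro z
    induction z using ind_rec with | _ a x
    rfl
  · intro z
    induction z using ind_rec with | _ a x
    rfl

theorem indClass_comp {X Y Z : FinGSet H} (a : SpanClass X Y) (b : SpanClass Y Z) :
    indClass (SpanClass.comp a b) = SpanClass.comp (indClass a) (indClass b) := by
  induction a using SpanClass.ind with | _ S
  induction b using SpanClass.ind with | _ T
  let i : FinGSet.pullback S.right T.left →[H] S.apex :=
    { toFun := fun p => p.1.1, map_smul' := fun _ _ => rfl }
  let j : FinGSet.pullback S.right T.left →[H] T.apex :=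
    { toFun := fun p => p.1.2, map_smul' := fun _ _ => rfl }
  have key : ∀ p, indMap S.right (indMap i p) = indMap T.left (indMap j p) := by
    intro p
    induction p using ind_rec with | _ a x
    exact congrArg (indMk a) x.2
  refine SpanClass.sound (Equiv.ofBijective
    (fun p => ⟨(indMap i p, indMap j p), key p⟩) ⟨?_, ?_⟩) ?_ ?_ ?_
  · intro p q hpq
    induction p using ind_rec with | _ a x
    induction q using ind_rec with | _ b y
    have e1 := congrArg (fun z => z.1.1) hpq
    have e2 := congrArg (fun z => z.1.2) hpq
    obtain ⟨h, h1, h2⟩ := indMk_eq.1 e1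
    obtain ⟨k, k1, k2⟩ := indMk_eq.1 e2
    have hk : h = k := Subtype.ext (mul_left_cancel (h1.symm.trans k1))
    subst hk
    exact indMk_eq.2 ⟨h, h1, Subtype.ext (Prod.ext h2 k2)⟩
  · rintro ⟨⟨p, q⟩, hpq⟩
    induction p using ind_rec with | _ a x
    induction q using ind_rec with | _ b y
    obtain ⟨h, h1, h2⟩ := indMk_eq.1 hpq
    refine ⟨indMk b ⟨(h • x, y), (map_smul S.right h x).trans h2.symm⟩, ?_⟩
    exact Subtype.ext (Prod.ext (indMk_eq.2 ⟨h, h1, rfl⟩).symm rfl)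
  · intro g p
    exact Subtype.ext (Prod.ext (map_smul (indMap i) g p) (map_smul (indMap j) g p))
  · intro p
    induction p using ind_rec with | _ a x
    rfl
  · intro p
    induction p using ind_rec with | _ a x
    rfl

variable (H)

/-- The induction functor `G ×_H (-)` from the Burnside category of `H` to that of `G`. -/
def indFunctor : BurnsideCat H ⥤ BurnsideCat G where
  obj X := .of (ind H X.set)
  map f := GrothendieckAddGroup.lift (GrothendieckAddGroup.of.comp indClass) f
  map_id X := by
    change GrothendieckAddGroup.lift _ (GrothendieckAddGroup.of _) = _
    rw [lift_of, AddMonoidHom.comp_apply, indClass_id]; rfl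
  map_comp {X Y Z} f g := by
    change GrothendieckAddGroup.lift _ (lift₂ SpanClass.comp f g) = lift₂ SpanClass.comp _ _
    induction f using groth_ind with
    | of a =>
      induction g using groth_ind with
      | of b =>
        simp only [lift₂_of, lift_of, AddMonoidHom.comp_apply, indClass_comp]
      | sub x y hx hy => simp only [map_sub, hx, hy]
    | sub x y hx hy => simp only [map_sub, AddMonoidHom.sub_apply, hx, hy]

instance : (indFunctor H).Additive where
  map_add {X Y} f g :=
    map_add (GrothendieckAddGroup.lift (GrothendieckAddGroup.of.comp
      (indClass (X := X.set) (Y := Y.set)))) f g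

end Induction

/-! ### The Burnside category is essentially small -/

section Small

theorem finite_mulAction [Finite G] (n : ℕ) : Finite (MulAction G (ULift.{u} (Fin n))) :=
  Finite.of_injective
    (fun (a : MulAction G (ULift.{u} (Fin n))) (g : G) (x : ULift.{u} (Fin n)) => a.smul g x)
    (fun _ _ h => MulAction.ext h)

/-- The `G`-set with underlying set `{0, …, n - 1}` and a given action. -/
def finSet (n : ℕ) (a : MulAction G (ULift.{u} (Fin n))) : FinGSet G where
  carrier := ULift.{u} (Fin n)

theorem exists_finSet (X : FinGSet G) : ∃ (n : ℕ) (a : MulAction G (ULift.{u} (Fin n)))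
    (e : finSet n a ≃ X), ∀ (g : G) (x : finSet n a), e (g • x) = g • e x := by
  obtain ⟨n, ⟨e⟩⟩ := Finite.exists_equiv_fin X
  let e' : ULift.{u} (Fin n) ≃ X := Equiv.ulift.trans e.symm
  let a : MulAction G (ULift.{u} (Fin n)) :=
    { smul := fun g x => e'.symm (g • e' x)
      one_smul := fun x => by
        change e'.symm (_ • _) = x
        simp
      mul_smul := fun g h x => by
        change e'.symm (_ • _) = e'.symm (g • e' (e'.symm (h • e' x)))
        simp [mul_smul] }
  exact ⟨n, a, e', fun g x => e'.apply_symm_apply _⟩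

theorem finite_hom (X Y : FinGSet G) : Finite (X →[G] Y) :=
  Finite.of_injective (fun (f : X →[G] Y) (x : X) => f x) DFunLike.coe_injective

theorem countable_spanClass [Finite G] (X Y : FinGSet G) : Countable (SpanClass X Y) := by
  have h1 := fun n => finite_mulAction (G := G) n
  have h2 := fun Z : FinGSet G => finite_hom Z X
  have h3 := fun Z : FinGSet G => finite_hom Z Y
  let φ : (Σ (n : ℕ) (a : MulAction G (ULift.{u} (Fin n))),
      (finSet n a →[G] X) × (finSet n a →[G] Y)) → SpanClass X Y :=
    fun p => SpanClass.mk ⟨finSet p.1 p.2.1, p.2.2.1, p.2.2.2⟩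
  refine Function.Surjective.countable (f := φ) ?_
  intro s
  induction s using SpanClass.ind with | _ S
  obtain ⟨n, a, e, he⟩ := exists_finSet S.apex
  let i : finSet n a →[G] S.apex := { toFun := e, map_smul' := he }
  exact ⟨⟨n, a, S.left.comp i, S.right.comp i⟩,
    SpanClass.sound e he (fun _ => rfl) (fun _ => rfl)⟩

instance [Finite G] (X Y : BurnsideCat G) : Countable (X ⟶ Y) := by
  have := countable_spanClass X.set Y.set
  let φ : SpanClass X.set Y.set × SpanClass X.set Y.set → (X ⟶ Y) := fun p =>
    AddLocalization.mk p.1 ⟨p.2, trivial⟩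
  refine Function.Surjective.countable (f := φ) fun f => ?_
  induction f using AddLocalization.ind with | _ y
  exact ⟨(y.1, y.2.1), rfl⟩

/-- An equivariant bijection gives an isomorphism in the Burnside category. -/
def isoOfEquiv {X Y : FinGSet G} (e : X ≃ Y) (he : ∀ (g : G) (x : X), e (g • x) = g • e x) :
    BurnsideCat.of X ≅ BurnsideCat.of Y where
  hom := BurnsideCat.ofSpan ⟨X, MulActionHom.id G, { toFun := e, map_smul' := he }⟩
  inv := BurnsideCat.ofSpan ⟨X, { toFun := e, map_smul' := he }, MulActionHom.id G⟩
  hom_inv_id := by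
    rw [BurnsideCat.ofSpan_comp, ← BurnsideCat.ofSpan_id]
    refine BurnsideCat.ofSpan_eq
      { toFun := fun p => p.1.1, invFun := fun x => ⟨(x, x), rfl⟩
        left_inv := ?_, right_inv := fun _ => rfl } ?_ ?_ ?_
    · rintro ⟨⟨x, y⟩, h⟩
      exact Subtype.ext (Prod.ext rfl (e.injective h))
    · intro g p; rfl
    · intro p; rfl
    · rintro ⟨⟨x, y⟩, h⟩
      exact e.injective h
  inv_hom_id := by
    rw [BurnsideCat.ofSpan_comp, ← BurnsideCat.ofSpan_id]
    refine BurnsideCat.ofSpan_eq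
      { toFun := fun p => e p.1.1, invFun := fun x => ⟨(e.symm x, e.symm x), rfl⟩
        left_inv := ?_, right_inv := fun x => e.apply_symm_apply x } ?_ ?_ ?_
    · rintro ⟨⟨x, y⟩, h⟩
      have h' : x = y := h
      subst h'
      exact Subtype.ext (Prod.ext (e.symm_apply_apply x) (e.symm_apply_apply x))
    · intro g p
      exact he g p.1.1
    · intro p; rfl
    · rintro ⟨⟨x, y⟩, h⟩
      have h' : x = y := h
      subst h'
      rfl

instance [Finite G] : EssentiallySmall.{w} (BurnsideCat G) := by
  rw [essentiallySmall_iff]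
  refine ⟨?_, ⟨fun X Y => inferInstance⟩⟩
  have h1 := fun n => finite_mulAction (G := G) n
  let φ : (Σ n : ℕ, MulAction G (ULift.{u} (Fin n))) → Skeleton (BurnsideCat G) :=
    fun p => toSkeleton (BurnsideCat.of (finSet p.1 p.2))
  have : Countable (Skeleton (BurnsideCat G)) := by
    refine Function.Surjective.countable (f := φ) fun z => ?_
    obtain ⟨X, rfl⟩ := Quotient.exists_rep z
    obtain ⟨n, a, e, he⟩ := exists_finSet X.set
    exact ⟨⟨n, a⟩, congr_toSkeleton_of_iso (isoOfEquiv (X := finSet n a) (Y := X.set) e he)⟩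
  infer_instance

end Small

/-! ### Mackey functors, the box product and flatness -/

/-- The category of Mackey functors for `G`: additive functors from the Burnside category to
abelian groups, and natural transformations. -/
abbrev Mackey (G : Type u) [Group G] := BurnsideCat G ⥤+ AddCommGrpCat.{w}

/-- The tensor product `(A, B) ↦ A ⊗_ℤ B` of abelian groups. -/
def tensorAb : AddCommGrpCat.{w} × AddCommGrpCat.{w} ⥤ AddCommGrpCat.{w} where
  obj P := AddCommGrpCat.of (P.1 ⊗[ℤ] P.2)
  map f := AddCommGrpCat.ofHom
    (TensorProduct.map f.1.hom.toIntLinearMap f.2.hom.toIntLinearMap).toAddMonoidHom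
  map_id P := by
    ext x
    induction x using TensorProduct.induction_on with
    | zero => simp
    | tmul a b => simp
    | add x y hx hy => rw [map_add, hx, hy, map_add]
  map_comp f g := by
    ext x
    induction x using TensorProduct.induction_on with
    | zero => simp
    | tmul a b => simp
    | add x y hx hy => rw [map_add, hx, hy, map_add]

theorem tensorAb_map_add {A B C D : AddCommGrpCat.{w}} (f : A ⟶ B) (g g' : C ⟶ D) :
    tensorAb.map (X := (A, C)) (Y := (B, D)) (f, g + g') =
      tensorAb.map (X := (A, C)) (Y := (B, D)) (f, g) +
        tensorAb.map (X := (A, C)) (Y := (B, D)) (f, g') := by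
  apply AddCommGrpCat.hom_ext
  ext x
  exact DFunLike.congr_fun (TensorProduct.map_add_right (R := ℤ) f.hom.toIntLinearMap
    g.hom.toIntLinearMap g'.hom.toIntLinearMap) x

/-- The external tensor product with `M`, sending `N` to `(X, Y) ↦ N(X) ⊗ M(Y)`. -/
def external {C : Type*} [Category C] (M : C ⥤ AddCommGrpCat.{w}) :
    (C ⥤ AddCommGrpCat.{w}) ⥤ (C × C ⥤ AddCommGrpCat.{w}) where
  obj N := N.prod M ⋙ tensorAb
  map α := Functor.whiskerRight (NatTrans.prod α (𝟙 M)) tensorAb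
  map_id N := NatTrans.ext (funext fun P => tensorAb.map_id (N.obj P.1, M.obj P.2))
  map_comp {N N' N''} α β := NatTrans.ext (funext fun P => by
    have h := tensorAb.map_comp (X := (N.obj P.1, M.obj P.2)) (Y := (N'.obj P.1, M.obj P.2))
      (Z := (N''.obj P.1, M.obj P.2)) (α.app P.1, 𝟙 _) (β.app P.1, 𝟙 _)
    rw [prod_comp, Category.comp_id] at h
    exact h)

section Box

instance [Finite G] (Z : BurnsideCat G) :
    HasColimitsOfShape (CostructuredArrow (BurnsideCat.times G) Z) AddCommGrpCat.{w} :=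
  have : EssentiallySmall.{w} (BurnsideCat G × BurnsideCat G) :=
    EssentiallySmall.mk' ((equivSmallModel.{w} (BurnsideCat G)).prod
      (equivSmallModel.{w} (BurnsideCat G)))
  hasColimitsOfShape_of_essentiallySmall.{w} _ _

/-- A left Kan extension of `(X, Y) ↦ N(X) ⊗ M(Y)` along the cartesian product is additive. -/
theorem additive_of_isLeftKanExtension (N M : Mackey.{u, w} G)
    (L : BurnsideCat G ⥤ AddCommGrpCat.{w})
    (η : (external M.obj).obj N.obj ⟶ BurnsideCat.times G ⋙ L)
    (hL : (Functor.LeftExtension.mk L η).IsPointwiseLeftKanExtension) : L.Additive where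
  map_add {Z Z'} f g := by
    have key : ∀ {X Y Z : BurnsideCat G} (s t : (BurnsideCat.times G).obj (X, Y) ⟶ Z),
        η.app (X, Y) ≫ L.map (s + t) = η.app (X, Y) ≫ L.map s + η.app (X, Y) ≫ L.map t := by
      intro X Y Z s t
      let T : ∀ {Y Y' : BurnsideCat G}, (Y ⟶ Y') →
          ((BurnsideCat.times G).obj (X, Y) ⟶ (BurnsideCat.times G).obj (X, Y')) :=
        fun {Y Y'} g => (BurnsideCat.times G).map (X := (X, Y)) (Y := (X, Y')) (𝟙 X, g)
      have T_comp : ∀ {Y Y' Y'' : BurnsideCat G} (g : Y ⟶ Y') (g' : Y' ⟶ Y''),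
          T g ≫ T g' = T (g ≫ g') := fun {Y Y' Y''} g g' => by
        have h := (BurnsideCat.times G).map_comp (X := (X, Y)) (Y := (X, Y')) (Z := (X, Y''))
          (𝟙 X, g) (𝟙 X, g')
        rw [prod_comp, Category.comp_id] at h
        exact h.symm
      have T_id : ∀ Y : BurnsideCat G, T (𝟙 Y) = 𝟙 _ := fun Y =>
        (BurnsideCat.times G).map_id (X, Y)
      have T_add : ∀ {Y Y' : BurnsideCat G} (g g' : Y ⟶ Y'), T (g + g') = T g + T g' :=
        fun g g' => BurnsideCat.times_map_add _ g g'
      have T_zero : ∀ {Y Y' : BurnsideCat G}, T (0 : Y ⟶ Y') = 0 :=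
        BurnsideCat.times_map_zero _
      let E : ∀ {Y Y' : BurnsideCat G}, (Y ⟶ Y') →
          (((external M.obj).obj N.obj).obj (X, Y) ⟶ ((external M.obj).obj N.obj).obj (X, Y')) :=
        fun {Y Y'} g => ((external M.obj).obj N.obj).map (X := (X, Y)) (Y := (X, Y')) (𝟙 X, g)
      have E_add : ∀ {Y Y' : BurnsideCat G} (g g' : Y ⟶ Y'), E (g + g') = E g + E g' :=
        fun {Y Y'} g g' => by
          have h := tensorAb_map_add (N.obj.map (𝟙 X)) (M.obj.map g) (M.obj.map g')
          rw [← Functor.map_add] at h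
          exact h
      have nat : ∀ {Y Y' : BurnsideCat G} (g : Y ⟶ Y'),
          η.app (X, Y) ≫ L.map (T g) = E g ≫ η.app (X, Y') := fun {Y Y'} g =>
        (η.naturality (X := (X, Y)) (Y := (X, Y')) (𝟙 X, g)).symm
      let inl : Y ⟶ BurnsideCat.of (Y.set.sum Y.set) :=
        BurnsideCat.ofSpan (BurnsideCat.spanInl Y.set Y.set)
      let inr : Y ⟶ BurnsideCat.of (Y.set.sum Y.set) :=
        BurnsideCat.ofSpan (BurnsideCat.spanInr Y.set Y.set)
      let fst : BurnsideCat.of (Y.set.sum Y.set) ⟶ Y :=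
        BurnsideCat.ofSpan (BurnsideCat.spanFst Y.set Y.set)
      let snd : BurnsideCat.of (Y.set.sum Y.set) ⟶ Y :=
        BurnsideCat.ofSpan (BurnsideCat.spanSnd Y.set Y.set)
      have h1 : inl ≫ fst = 𝟙 Y := BurnsideCat.inl_fst _ _
      have h2 : inl ≫ snd = 0 := BurnsideCat.inl_snd _ _
      have h3 : inr ≫ fst = 0 := BurnsideCat.inr_fst _ _
      have h4 : inr ≫ snd = 𝟙 Y := BurnsideCat.inr_snd _ _
      have hs : T inl ≫ (T fst ≫ s + T snd ≫ t) = s := by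
        rw [Preadditive.comp_add, ← Category.assoc, ← Category.assoc, T_comp, T_comp, h1, h2,
          T_id, T_zero, zero_comp, add_zero]
        exact Category.id_comp s
      have ht : T inr ≫ (T fst ≫ s + T snd ≫ t) = t := by
        rw [Preadditive.comp_add, ← Category.assoc, ← Category.assoc, T_comp, T_comp, h3, h4,
          T_id, T_zero, zero_comp, zero_add]
        exact Category.id_comp t
      have hst : T (inl + inr) ≫ (T fst ≫ s + T snd ≫ t) = s + t := by
        rw [T_add, Preadditive.add_comp, hs, ht]
      calc η.app (X, Y) ≫ L.map (s + t)
          = (η.app (X, Y) ≫ L.map (T (inl + inr))) ≫ L.map (T fst ≫ s + T snd ≫ t) := by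
            rw [← hst, Category.assoc, ← L.map_comp]
        _ = (η.app (X, Y) ≫ L.map (T inl)) ≫ L.map (T fst ≫ s + T snd ≫ t) +
              (η.app (X, Y) ≫ L.map (T inr)) ≫ L.map (T fst ≫ s + T snd ≫ t) := by
            rw [nat, nat, nat, E_add, Preadditive.add_comp, Preadditive.add_comp]
        _ = η.app (X, Y) ≫ L.map s + η.app (X, Y) ≫ L.map t := by
            rw [Category.assoc, Category.assoc, ← L.map_comp, ← L.map_comp, hs, ht]
    refine (hL Z).hom_ext fun j => ?_
    change (η.app j.left ≫ L.map j.hom) ≫ L.map (f + g) =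
      (η.app j.left ≫ L.map j.hom) ≫ (L.map f + L.map g)
    rw [Preadditive.comp_add, Category.assoc, Category.assoc, Category.assoc, ← L.map_comp,
      ← L.map_comp, ← L.map_comp, Preadditive.comp_add]
    exact key (X := j.left.1) (Y := j.left.2) _ _

instance [Finite G] (N M : Mackey.{u, w} G) :
    ((BurnsideCat.times G).lan.obj ((external M.obj).obj N.obj)).Additive :=
  additive_of_isLeftKanExtension N M _ _
    ((BurnsideCat.times G).isPointwiseLeftKanExtensionLeftKanExtensionUnit _)

/-- The functor `N ↦ N ⊠ M`: the box product `N ⊠ M` is the left Kan extension of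
`(X, Y) ↦ N(X) ⊗ M(Y)` along the cartesian product. -/
def boxRight [Finite G] (M : Mackey.{u, w} G) : Mackey.{u, w} G ⥤ Mackey.{u, w} G :=
  ObjectProperty.lift _
    (AdditiveFunctor.forget _ _ ⋙ external M.obj ⋙ (BurnsideCat.times G).lan)
    (fun N => inferInstanceAs
      ((BurnsideCat.times G).lan.obj ((external M.obj).obj N.obj)).Additive)

/-- A Mackey functor `M` is flat if `- ⊠ M` is exact, i.e. preserves finite limits and finite
colimits. -/
def IsFlat [Finite G] (M : Mackey.{u, w} G) : Prop := exactFunctor _ _ (boxRight M)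

end Box

/-- The restriction functor `i_H^*` from Mackey functors for `G` to Mackey functors for `H`,
given by precomposition with `G ×_H (-)`. -/
def restriction [Finite G] (H : Subgroup G) : Mackey.{u, w} G ⥤ Mackey.{u, w} H :=
  ObjectProperty.lift _
    (AdditiveFunctor.forget _ _ ⋙ (Functor.whiskeringLeft _ _ _).obj (indFunctor H))
    (fun M => inferInstanceAs (indFunctor H ⋙ M.obj).Additive)

end Equivariant
end

noncomputable section

namespace Equivariant

open Algebra

variable {G : Type u} [Group G]

/-! ### Comparison of spans along cartesian squares -/

namespace BurnsideCat

/-! Write Ind for `indFunctor H` and Res for `resFunctor H`, between the two Burnside categories.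
The proof realises `- ⊠ i_H^* M` as a retract of an exact functor.

Since a span can be read in both directions, Ind is both left and right adjoint to Res (`indResAdj`,
`resIndAdj`). Hence induction of Mackey functors, which is precomposition with Res, is both left and
right adjoint to restriction, which is precomposition with Ind. Both functors therefore preserve
finite limits and finite colimits.

The bijection `G ×_H (X × Res Y) ≅ (G ×_H X) × Y` (`projIso`) lifts to the projection formula `Ind
(N ⊠ i_H^* M) ≅ Ind N ⊠ M` (`boxRightInductionIso`). The two sides come from left adjoints whose
right adjoints are precomposition with the two sides of the bijection (`lanProjIso`). So if `M` is
flat, `N ↦ i_H^* Ind (N ⊠ i_H^* M)` is exact, being isomorphic to the composite of induction, `- ⊠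
M` and restriction.

Finally, `X → G ×_H X` is injective, so its forward span followed by its backward span is the
identity. Every `N` is thus a natural retract of `i_H^* Ind N`
(`toRestrictionInduction_ofRestrictionInduction`), and `- ⊠ i_H^* M` is a retract of the exact
functor above. Retracts of exact functors are exact (`exactFunctor_of_retract`). -/

/-- The span `X ← X → Y` of a map `X → Y`. -/
def forward {X Y : FinGSet G} (f : X →[G] Y) : of X ⟶ of Y :=
  ofSpan ⟨X, MulActionHom.id G, f⟩

/-- The span `Y ← X → X` of a map `X → Y`. -/
def backward {X Y : FinGSet G} (f : X →[G] Y) : of Y ⟶ of X :=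
  ofSpan ⟨X, f, MulActionHom.id G⟩

/-- The triple `(p, q, p')` is a map of spans from `S` to `T`, and `inj` and `surj` say that its
left square is cartesian. The composite on the left has apex `S.apex`, the one on the right has apex
the pullback of `X` and `T.apex` over `Y`, and these agree exactly when that square is cartesian. -/
theorem ofSpan_forward_eq {X X' Y Y' : FinGSet G} (S : GSpan X X') (T : GSpan Y Y')
    (p : X →[G] Y) (p' : X' →[G] Y') (q : S.apex →[G] T.apex)
    (hl : ∀ a, T.left (q a) = p (S.left a)) (hr : ∀ a, T.right (q a) = p' (S.right a))
    (inj : ∀ a a', S.left a = S.left a' → q a = q a' → a = a')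
    (surj : ∀ x b, p x = T.left b → ∃ a, S.left a = x ∧ q a = b) :
    ofSpan S ≫ forward p' = forward p ≫ ofSpan T := by
  rw [forward, forward, ofSpan_comp, ofSpan_comp]
  let e : S.apex ≃ ((⟨X, MulActionHom.id G, p⟩ : GSpan X Y).comp T).apex :=
    Equiv.ofBijective (fun a => ⟨(S.left a, q a), (hl a).symm⟩)
      ⟨fun a a' h => inj a a' (congrArg (fun z => z.1.1) h) (congrArg (fun z => z.1.2) h),
        fun ⟨⟨x, b⟩, h⟩ => by
          obtain ⟨a, rfl, rfl⟩ := surj x b h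
          exact ⟨a, rfl⟩⟩
  -- Composing with a forward span does not change the apex, up to this bijection.
  let d : (S.comp (⟨X', MulActionHom.id G, p'⟩ : GSpan X' Y')).apex ≃ S.apex :=
    { toFun := fun z => z.1.1
      invFun := fun a => ⟨(a, S.right a), rfl⟩
      left_inv := fun ⟨⟨a, x⟩, h⟩ => Subtype.ext (Prod.ext rfl h)
      right_inv := fun _ => rfl }
  refine ofSpan_eq (d.trans e) (fun g z => ?_) (fun z => rfl) fun z => ?_
  · exact Subtype.ext (Prod.ext (map_smul S.left g z.1.1) (map_smul q g z.1.1))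
  · exact (hr z.1.1).trans (congrArg p' z.2)

/-- The mirror image of `ofSpan_forward_eq`: here the right square of the map of spans has to be
cartesian. -/
theorem backward_ofSpan_eq {X X' Y Y' : FinGSet G} (S : GSpan X X') (T : GSpan Y Y')
    (p : X →[G] Y) (p' : X' →[G] Y') (q : S.apex →[G] T.apex)
    (hl : ∀ a, T.left (q a) = p (S.left a)) (hr : ∀ a, T.right (q a) = p' (S.right a))
    (inj : ∀ a a', S.right a = S.right a' → q a = q a' → a = a')
    (surj : ∀ x b, p' x = T.right b → ∃ a, S.right a = x ∧ q a = b) :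
    backward p ≫ ofSpan S = ofSpan T ≫ backward p' := by
  rw [backward, backward, ofSpan_comp, ofSpan_comp]
  let e : S.apex ≃ (T.comp (⟨X', p', MulActionHom.id G⟩ : GSpan Y' X')).apex :=
    Equiv.ofBijective (fun a => ⟨(q a, S.right a), hr a⟩)
      ⟨fun a a' h => inj a a' (congrArg (fun z => z.1.2) h) (congrArg (fun z => z.1.1) h),
        fun ⟨⟨b, x⟩, h⟩ => by
          obtain ⟨a, rfl, rfl⟩ := surj x b h.symm
          exact ⟨a, rfl⟩⟩
  let d : ((⟨X, p, MulActionHom.id G⟩ : GSpan Y X).comp S).apex ≃ S.apex :=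
    { toFun := fun z => z.1.2
      invFun := fun a => ⟨(S.left a, a), rfl⟩
      left_inv := fun ⟨⟨x, a⟩, h⟩ => Subtype.ext (Prod.ext (Eq.symm h) rfl)
      right_inv := fun _ => rfl }
  refine ofSpan_eq (d.trans e) (fun g z => ?_) (fun z => ?_) fun z => rfl
  · exact Subtype.ext (Prod.ext (map_smul q g z.1.2) (map_smul S.right g z.1.2))
  · exact (hl z.1.2).trans (congrArg p (Eq.symm z.2))

theorem forward_comp {X Y Z : FinGSet G} (f : X →[G] Y) (g : Y →[G] Z) :
    forward f ≫ forward g = forward (g.comp f) := by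
  rw [forward, forward, forward, ofSpan_comp]
  exact ofSpan_eq
    { toFun := fun z => z.1.1
      invFun := fun x => ⟨(x, f x), rfl⟩
      left_inv := fun ⟨⟨a, x⟩, h⟩ => Subtype.ext (Prod.ext rfl h)
      right_inv := fun _ => rfl } (fun _ _ => rfl) (fun _ => rfl)
      (fun z => congrArg g z.2)

theorem backward_comp {X Y Z : FinGSet G} (f : X →[G] Y) (g : Y →[G] Z) :
    backward g ≫ backward f = backward (g.comp f) := by
  rw [backward, backward, backward, ofSpan_comp]
  exact ofSpan_eq
    { toFun := fun z => z.1.2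
      invFun := fun x => ⟨(f x, x), rfl⟩
      left_inv := fun ⟨⟨a, x⟩, h⟩ => Subtype.ext (Prod.ext (Eq.symm h) rfl)
      right_inv := fun _ => rfl } (fun _ _ => rfl)
      (fun z => congrArg g (Eq.symm z.2)) (fun _ => rfl)

/-- The apex is the pullback of `f` with itself, which is the diagonal when `f` is injective. -/
theorem forward_backward {X Y : FinGSet G} (f : X →[G] Y) (hf : Function.Injective f) :
    forward f ≫ backward f = 𝟙 (of X) := by
  rw [forward, backward, ofSpan_comp, ← ofSpan_id]
  exact ofSpan_eq
    { toFun := fun z => z.1.1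
      invFun := fun x => ⟨(x, x), rfl⟩
      left_inv := fun ⟨⟨a, x⟩, h⟩ => Subtype.ext (Prod.ext rfl (hf h))
      right_inv := fun _ => rfl } (fun _ _ => rfl) (fun _ => rfl) (fun z => hf z.2)

/-- Additive functors out of the Burnside category are determined on spans: a family of maps that
is natural with respect to spans is natural. -/
theorem naturality_of_ofSpan {C : Type*} [Category C] [Preadditive C] {F F' : BurnsideCat G ⥤ C}
    [F.Additive] [F'.Additive] (α : ∀ X, F.obj X ⟶ F'.obj X)
    (h : ∀ {X Y : FinGSet G} (S : GSpan X Y),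
      F.map (ofSpan S) ≫ α (of Y) = α (of X) ≫ F'.map (ofSpan S))
    {X Y : BurnsideCat G} (f : X ⟶ Y) : F.map f ≫ α Y = α X ≫ F'.map f := by
  induction f using hom_ind with
  | ofSpan S => exact h S
  | sub f g hf hg =>
    rw [Functor.map_sub, Functor.map_sub, Preadditive.sub_comp, Preadditive.comp_sub, hf, hg]

end BurnsideCat

/-! ### Restriction of finite `G`-sets -/

section Restriction

variable (H : Subgroup G)

/-- The restriction of a `G`-set to `H`. -/
def res (X : FinGSet G) : FinGSet H where
  carrier := X
  action := MulAction.compHom X H.subtype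

variable {H}

/-- The restriction of an equivariant map. -/
def resMap {X Y : FinGSet G} (f : X →[G] Y) : res H X →[H] res H Y where
  toFun := fun x => f x
  map_smul' h x := map_smul f (h : G) (show X from x)

/-- The restriction of a span. -/
def resSpan {X Y : FinGSet G} (S : GSpan X Y) : GSpan (res H X) (res H Y) where
  apex := res H S.apex
  left := resMap S.left
  right := resMap S.right

/-- Restriction on classes of spans. -/
def resClass {X Y : FinGSet G} : SpanClass X Y →+ SpanClass (res H X) (res H Y) where
  toFun := Quotient.map resSpan (by
    rintro S T ⟨e, h1, h2, h3⟩
    exact ⟨e, fun h a => h1 h a, h2, h3⟩)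
  map_zero' := SpanClass.sound (Equiv.refl _) (fun _ x => PEmpty.elim x) (fun x => PEmpty.elim x)
    (fun x => PEmpty.elim x)
  map_add' a b := by
    induction a using SpanClass.ind with | _ S
    induction b using SpanClass.ind with | _ T
    refine SpanClass.sound (Equiv.refl _) ?_ ?_ ?_
    · rintro h (a | a) <;> rfl
    · rintro (a | a) <;> rfl
    · rintro (a | a) <;> rfl

theorem resClass_id (X : FinGSet G) :
    resClass (H := H) (SpanClass.mk (GSpan.id X)) = SpanClass.mk (GSpan.id (res H X)) :=
  SpanClass.sound (Equiv.refl _) (fun _ _ => rfl) (fun _ => rfl) (fun _ => rfl)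

/-- Fibre products of `G`-sets and of `H`-sets have the same underlying set, so the identity
bijection serves. -/
theorem resClass_comp {X Y Z : FinGSet G} (a : SpanClass X Y) (b : SpanClass Y Z) :
    resClass (H := H) (SpanClass.comp a b) = SpanClass.comp (resClass a) (resClass b) := by
  induction a using SpanClass.ind with | _ S
  induction b using SpanClass.ind with | _ T
  exact SpanClass.sound (Equiv.refl _) (fun _ _ => rfl) (fun _ => rfl) (fun _ => rfl)

variable (H)

/-- The restriction functor from the Burnside category of `G` to that of `H`. -/
def resFunctor : BurnsideCat G ⥤ BurnsideCat H where
  obj X := .of (res H X.set)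
  map f := GrothendieckAddGroup.lift (GrothendieckAddGroup.of.comp resClass) f
  map_id X := by
    change GrothendieckAddGroup.lift _ (GrothendieckAddGroup.of _) = _
    rw [lift_of, AddMonoidHom.comp_apply, resClass_id]; rfl
  map_comp {X Y Z} f g := by
    change GrothendieckAddGroup.lift _ (lift₂ SpanClass.comp f g) = lift₂ SpanClass.comp _ _
    induction f using groth_ind with
    | of a =>
      induction g using groth_ind with
      | of b =>
        simp only [lift₂_of, lift_of, AddMonoidHom.comp_apply, resClass_comp]
      | sub x y hx hy => simp only [map_sub, hx, hy]
    | sub x y hx hy => simp only [map_sub, AddMonoidHom.sub_apply, hx, hy]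

instance : (resFunctor H).Additive where
  map_add {X Y} f g :=
    map_add (GrothendieckAddGroup.lift (GrothendieckAddGroup.of.comp
      (resClass (H := H) (X := X.set) (Y := Y.set)))) f g

variable {H}

theorem resFunctor_map_ofSpan {X Y : FinGSet G} (S : GSpan X Y) :
    (resFunctor H).map (BurnsideCat.ofSpan S) = BurnsideCat.ofSpan (resSpan S) :=
  lift_of _ _

theorem resFunctor_map_forward {X Y : FinGSet G} (f : X →[G] Y) :
    (resFunctor H).map (BurnsideCat.forward f) = BurnsideCat.forward (resMap (H := H) f) :=
  resFunctor_map_ofSpan _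

theorem resFunctor_map_backward {X Y : FinGSet G} (f : X →[G] Y) :
    (resFunctor H).map (BurnsideCat.backward f) = BurnsideCat.backward (resMap (H := H) f) :=
  resFunctor_map_ofSpan _

variable [Finite G]

theorem indFunctor_map_ofSpan {X Y : FinGSet H} (S : GSpan X Y) :
    (indFunctor H).map (BurnsideCat.ofSpan S) = BurnsideCat.ofSpan (indSpan S) :=
  lift_of _ _

/-- This needs a choice of representatives in the quotient; it does not hold by unfolding. Thus Ind
of a forward or backward span has to be rewritten with it, while for Res the legs agree at once. -/
theorem indMap_id (X : FinGSet H) : indMap (MulActionHom.id H : X →[H] X) = MulActionHom.id G := by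
  ext z
  induction z using ind_rec with | _ a x
  rfl

theorem indFunctor_map_forward {X Y : FinGSet H} (f : X →[H] Y) :
    (indFunctor H).map (BurnsideCat.forward f) = BurnsideCat.forward (indMap f) := by
  rw [BurnsideCat.forward, indFunctor_map_ofSpan, indSpan]
  simp only [indMap_id]
  rfl

theorem indFunctor_map_backward {X Y : FinGSet H} (f : X →[H] Y) :
    (indFunctor H).map (BurnsideCat.backward f) = BurnsideCat.backward (indMap f) := by
  rw [BurnsideCat.backward, indFunctor_map_ofSpan, indSpan]
  simp only [indMap_id]
  rfl

/-! ### Induction is both left and right adjoint to restriction -/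

/-- The map `X → G ×_H X`, `x ↦ [1, x]`. -/
def indUnit (X : FinGSet H) : X →[H] res H (ind H X) where
  toFun x := indMk (1 : G) x
  -- In `G ×_H X` one has `[1, h x] = [h, x]`; the witness is `h⁻¹` because `1 = h * h⁻¹` and `x =
  -- h⁻¹ (h x)`.
  map_smul' h x := indMk_eq.2 ⟨h⁻¹, by simp, by simp⟩

theorem indUnit_injective (X : FinGSet H) : Function.Injective (indUnit X) := by
  intro x y hxy
  obtain ⟨h, h1, h2⟩ := indMk_eq.1 hxy
  have : h = 1 := Subtype.ext (by simpa using h1.symm)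
  rw [h2, this, one_smul]

/-- The map `G ×_H X → X`, `[g, x] ↦ g x`, for a `G`-set `X`. -/
def indCounit (X : FinGSet G) : ind H (res H X) →[G] X where
  toFun := Quotient.lift (fun p => p.1 • (show X from p.2)) (by
    rintro ⟨a, x⟩ ⟨b, y⟩ ⟨h, h1, h2⟩
    dsimp only at h1 h2 ⊢
    subst h1 h2
    exact mul_smul b (h : G) (show X from x))
  map_smul' g z := by
    induction z using ind_rec with | _ a x
    exact mul_smul g a (show X from x)

/-- With the injectivity of `indUnit`, this makes the naturality square of `indUnit` cartesian. The
image of `X` in `G ×_H X` is the part lying over the trivial coset, and `indMap f` preserves cosets: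
if `[a, f x] = [1, y]` then `a ∈ H`, so `[a, x]` can be rewritten with first entry `1`. -/
theorem indMap_indUnit_eq {X Y : FinGSet H} (f : X →[H] Y) {y : Y} {z : ind H X}
    (h : indUnit Y y = resMap (H := H) (indMap f) z) : ∃ x, f x = y ∧ indUnit X x = z := by
  induction z using ind_rec with | _ a x
  obtain ⟨k, h1, h2⟩ := indMk_eq.1 h
  refine ⟨k⁻¹ • x, ?_, indMk_eq.2 ⟨k, h1, by simp⟩⟩
  rw [map_smul, inv_smul_eq_iff]
  exact h2

/-- For a `G`-set `X`, `[a, x] ↦ (aH, a x)` identifies `G ×_H X` with `G/H × X`, turning `indCounit`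
into the second projection. The naturality square of `indCounit` is therefore cartesian; this is the
uniqueness half, in which only the coset is extracted from `h1`. -/
theorem indCounit_inj {X Y : FinGSet G} (f : X →[G] Y) {z z' : ind H (res H X)}
    (h1 : indMap (resMap f) z = indMap (resMap f) z') (h2 : indCounit X z = indCounit X z') :
    z = z' := by
  induction z using ind_rec with | _ a x
  induction z' using ind_rec with | _ b y
  obtain ⟨k, k1, -⟩ := indMk_eq.1 h1
  have k2 : a = b * (k : G) := k1
  have h3 : a • (show X from x) = b • (show X from y) := h2
  rw [k2, mul_smul] at h3
  exact indMk_eq.2 ⟨k, k1, (smul_left_cancel b h3).symm⟩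

/-- The existence half of the same cartesian square. -/
theorem indCounit_surj {X Y : FinGSet G} (f : X →[G] Y) {z : ind H (res H Y)} {x : X}
    (h : indCounit Y z = f x) : ∃ t, indMap (resMap f) t = z ∧ indCounit X t = x := by
  induction z using ind_rec with | _ a y
  -- The only candidate with first entry `a` that the action map sends to `x`.
  refine ⟨indMk a (show res H X from a⁻¹ • x), ?_, ?_⟩
  · refine congrArg (indMk a) ?_
    have h' : a • (show Y from y) = f x := h
    exact (map_smul f a⁻¹ x).trans (inv_smul_eq_iff.2 h'.symm)
  · exact smul_inv_smul a x

/-- Naturality of the unit of Ind ⊣ Res. The squares of `indUnit` over both legs of `S` are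
cartesian; the forward direction uses the left leg, and `backward_indUnit_ofSpan` the right leg, to
give the counit of Res ⊣ Ind. -/
theorem ofSpan_forward_indUnit {X Y : FinGSet H} (S : GSpan X Y) :
    BurnsideCat.ofSpan S ≫ BurnsideCat.forward (indUnit Y) =
      BurnsideCat.forward (indUnit X) ≫ BurnsideCat.ofSpan (resSpan (indSpan S)) :=
  BurnsideCat.ofSpan_forward_eq S (resSpan (indSpan S)) (indUnit X) (indUnit Y) (indUnit S.apex)
    (fun _ => rfl) (fun _ => rfl) (fun _ _ _ h => indUnit_injective _ h)
    (fun _ _ h => indMap_indUnit_eq S.left h)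

theorem backward_indUnit_ofSpan {X Y : FinGSet H} (S : GSpan X Y) :
    BurnsideCat.backward (indUnit X) ≫ BurnsideCat.ofSpan S =
      BurnsideCat.ofSpan (resSpan (indSpan S)) ≫ BurnsideCat.backward (indUnit Y) :=
  BurnsideCat.backward_ofSpan_eq S (resSpan (indSpan S)) (indUnit X) (indUnit Y) (indUnit S.apex)
    (fun _ => rfl) (fun _ => rfl) (fun _ _ _ h => indUnit_injective _ h)
    (fun _ _ h => indMap_indUnit_eq S.right h)

theorem indCounit_naturality {X Y : FinGSet G} (f : X →[G] Y) (z : ind H (res H X)) :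
    f (indCounit X z) = indCounit Y (indMap (resMap f) z) := by
  induction z using ind_rec with | _ a x
  exact map_smul f a (show X from x)

/-- Naturality of the counit of Ind ⊣ Res, from the cartesian square over the left leg. The right
leg gives `backward_indCounit_ofSpan`, the unit of Res ⊣ Ind. -/
theorem ofSpan_forward_indCounit {X Y : FinGSet G} (S : GSpan X Y) :
    BurnsideCat.ofSpan (indSpan (resSpan (H := H) S)) ≫ BurnsideCat.forward (indCounit Y) =
      BurnsideCat.forward (indCounit X) ≫ BurnsideCat.ofSpan S :=
  BurnsideCat.ofSpan_forward_eq (indSpan (resSpan (H := H) S)) S (indCounit X) (indCounit Y)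
    (indCounit S.apex) (indCounit_naturality S.left) (indCounit_naturality S.right)
    (fun _ _ h1 h2 => indCounit_inj S.left h1 h2) (fun _ _ h => indCounit_surj S.left h)

theorem backward_indCounit_ofSpan {X Y : FinGSet G} (S : GSpan X Y) :
    BurnsideCat.backward (indCounit X) ≫ BurnsideCat.ofSpan (indSpan (resSpan (H := H) S)) =
      BurnsideCat.ofSpan S ≫ BurnsideCat.backward (indCounit Y) :=
  BurnsideCat.backward_ofSpan_eq (indSpan (resSpan (H := H) S)) S (indCounit X) (indCounit Y)
    (indCounit S.apex) (indCounit_naturality S.left) (indCounit_naturality S.right)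
    (fun _ _ h1 h2 => indCounit_inj S.right h1 h2) (fun _ _ h => indCounit_surj S.right h)

/-! ### Units and counits of the two adjunctions -/

theorem indFunctor_comp_resFunctor_map_ofSpan {X Y : FinGSet H} (S : GSpan X Y) :
    (indFunctor H ⋙ resFunctor H).map (BurnsideCat.ofSpan S) =
      BurnsideCat.ofSpan (resSpan (indSpan S)) :=
  (congrArg (fun f => (resFunctor H).map f) (indFunctor_map_ofSpan S)).trans
    (resFunctor_map_ofSpan (indSpan S))

theorem resFunctor_comp_indFunctor_map_ofSpan {X Y : FinGSet G} (S : GSpan X Y) :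
    (resFunctor H ⋙ indFunctor H).map (BurnsideCat.ofSpan S) =
      BurnsideCat.ofSpan (indSpan (resSpan S)) :=
  (congrArg (fun f => (indFunctor H).map f) (resFunctor_map_ofSpan S)).trans
    (indFunctor_map_ofSpan (resSpan S))

variable (H)

/-- The inclusions `X → G ×_H X`, read forward. -/
def unitForward : 𝟭 (BurnsideCat H) ⟶ indFunctor H ⋙ resFunctor H where
  app X := BurnsideCat.forward (indUnit X.set)
  naturality _ _ f := BurnsideCat.naturality_of_ofSpan (F := 𝟭 (BurnsideCat H))
    (F' := indFunctor H ⋙ resFunctor H) (fun X => BurnsideCat.forward (indUnit X.set))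
    (fun {X _} S => (ofSpan_forward_indUnit S).trans
      (congrArg (fun t => BurnsideCat.forward (indUnit X) ≫ t)
        (indFunctor_comp_resFunctor_map_ofSpan S).symm)) f

/-- The inclusions `X → G ×_H X`, read backward. -/
def unitBackward : indFunctor H ⋙ resFunctor H ⟶ 𝟭 (BurnsideCat H) where
  app X := BurnsideCat.backward (indUnit X.set)
  naturality _ _ f := BurnsideCat.naturality_of_ofSpan (F := indFunctor H ⋙ resFunctor H)
    (F' := 𝟭 (BurnsideCat H)) (fun X => BurnsideCat.backward (indUnit X.set))
    (fun {_ Y} S => (congrArg (fun t => t ≫ BurnsideCat.backward (indUnit Y))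
        (indFunctor_comp_resFunctor_map_ofSpan S)).trans (backward_indUnit_ofSpan S).symm) f

/-- The action maps `G ×_H X → X`, read forward. -/
def counitForward : resFunctor H ⋙ indFunctor H ⟶ 𝟭 (BurnsideCat G) where
  app X := BurnsideCat.forward (indCounit X.set)
  naturality _ _ f := BurnsideCat.naturality_of_ofSpan (F := resFunctor H ⋙ indFunctor H)
    (F' := 𝟭 (BurnsideCat G)) (fun X => BurnsideCat.forward (indCounit X.set))
    (fun {_ Y} S => (congrArg (fun t => t ≫ BurnsideCat.forward (indCounit Y))
        (resFunctor_comp_indFunctor_map_ofSpan S)).trans (ofSpan_forward_indCounit S)) f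

/-- The action maps `G ×_H X → X`, read backward. -/
def counitBackward : 𝟭 (BurnsideCat G) ⟶ resFunctor H ⋙ indFunctor H where
  app X := BurnsideCat.backward (indCounit X.set)
  naturality _ _ f := BurnsideCat.naturality_of_ofSpan (F := 𝟭 (BurnsideCat G))
    (F' := resFunctor H ⋙ indFunctor H) (fun X => BurnsideCat.backward (indCounit X.set))
    (fun {X _} S => (backward_indCounit_ofSpan S).symm.trans
      (congrArg (fun t => BurnsideCat.backward (indCounit X) ≫ t)
        (resFunctor_comp_indFunctor_map_ofSpan S).symm)) f

/-- The source of the final retraction: the unit of one adjunction is split by the counit of the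
other. -/
theorem unitForward_unitBackward : unitForward H ≫ unitBackward H = 𝟙 _ :=
  NatTrans.ext (funext fun X => BurnsideCat.forward_backward _ (indUnit_injective X.set))

variable {H}

/-- This identity of equivariant maps and `resMap_indCounit_comp_indUnit` yield all four triangle
identities: through `forward` those of `indResAdj`, through the contravariant `backward`, with the
roles exchanged, those of `resIndAdj`. -/
theorem indCounit_comp_indMap_indUnit (X : FinGSet H) :
    (indCounit (ind H X)).comp (indMap (indUnit X)) = MulActionHom.id G := by
  ext z
  induction z using ind_rec with | _ a x
  exact (smul_indMk a 1 x).trans (congrArg (fun b => indMk b x) (mul_one a))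

theorem resMap_indCounit_comp_indUnit (X : FinGSet G) :
    (resMap (indCounit X)).comp (indUnit (res H X)) = MulActionHom.id H := by
  ext x
  exact one_smul G (show X from x)

variable (H)

/-- Induction is left adjoint to restriction. -/
def indResAdj : indFunctor H ⊣ resFunctor H where
  unit := unitForward H
  counit := counitForward H
  left_triangle_components X :=
    (congrArg (fun t => t ≫ BurnsideCat.forward (indCounit (ind H X.set)))
      (indFunctor_map_forward (indUnit X.set))).trans ((BurnsideCat.forward_comp _ _).trans
        (congrArg BurnsideCat.forward (indCounit_comp_indMap_indUnit X.set)))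
  right_triangle_components X :=
    (congrArg (fun t => BurnsideCat.forward (indUnit (res H X.set)) ≫ t)
      (resFunctor_map_forward (indCounit X.set))).trans ((BurnsideCat.forward_comp _ _).trans
        (congrArg BurnsideCat.forward (resMap_indCounit_comp_indUnit X.set)))

/-- Induction is right adjoint to restriction. -/
def resIndAdj : resFunctor H ⊣ indFunctor H where
  unit := counitBackward H
  counit := unitBackward H
  left_triangle_components X :=
    (congrArg (fun t => t ≫ BurnsideCat.backward (indUnit (res H X.set)))
      (resFunctor_map_backward (indCounit X.set))).trans ((BurnsideCat.backward_comp _ _).trans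
        (congrArg BurnsideCat.backward (resMap_indCounit_comp_indUnit X.set)))
  right_triangle_components X :=
    (congrArg (fun t => BurnsideCat.backward (indCounit (ind H X.set)) ≫ t)
      (indFunctor_map_backward (indUnit X.set))).trans ((BurnsideCat.backward_comp _ _).trans
        (congrArg BurnsideCat.backward (indCounit_comp_indMap_indUnit X.set)))

end Restriction

end Equivariant
end

noncomputable section

/-! ### Formal preliminaries -/

section Formal

variable {C D C' D' : Type*} [Category C] [Category D] [Category C'] [Category D']

/-- The product of two adjunctions. -/
def CategoryTheory.Adjunction.prodAdj {F : C ⥤ D} {R : D ⥤ C} {F' : C' ⥤ D'} {R' : D' ⥤ C'}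
    (adj : F ⊣ R) (adj' : F' ⊣ R') : F.prod F' ⊣ R.prod R' where
  unit := { app := fun X => (adj.unit.app X.1, adj'.unit.app X.2)
            naturality := fun _ _ f =>
              Prod.ext (adj.unit.naturality f.1) (adj'.unit.naturality f.2) }
  counit := { app := fun X => (adj.counit.app X.1, adj'.counit.app X.2)
              naturality := fun _ _ f =>
                Prod.ext (adj.counit.naturality f.1) (adj'.counit.naturality f.2) }
  left_triangle_components X :=
    Prod.ext (adj.left_triangle_components X.1) (adj'.left_triangle_components X.2)
  right_triangle_components X :=
    Prod.ext (adj.right_triangle_components X.1) (adj'.right_triangle_components X.2)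

/-! ### Retracts of functors preserving limits or colimits -/

variable {F F' : C ⥤ D} (i : F ⟶ F') (r : F' ⟶ F) (h : i ≫ r = 𝟙 F)
include h

theorem CategoryTheory.Limits.preservesLimitsOfShape_of_retract {J : Type*} [Category J]
    [PreservesLimitsOfShape J F'] : PreservesLimitsOfShape J F where
  preservesLimit {K} :=
    { preserves := fun {c} hc => ⟨by
        have hr : ∀ X, i.app X ≫ r.app X = 𝟙 _ := fun X => congr_app h X
        have hc' := isLimitOfPreserves F' hc
        -- Push a cone on `K ⋙ F` forward along `i`, lift it through the limit cone of `F'`, and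
        -- return along `r`.
        refine
          { lift := fun s => hc'.lift ((Cone.postcompose (Functor.whiskerLeft K i)).obj s) ≫
              r.app c.pt
            fac := fun s j => ?_
            uniq := fun s m hm => ?_ }
        · have e := hc'.fac ((Cone.postcompose (Functor.whiskerLeft K i)).obj s) j
          dsimp at e ⊢
          rw [Category.assoc, ← r.naturality, reassoc_of% e, hr, Category.comp_id]
        -- After composing with the split monomorphism `i`, the map `m` is determined by the limit
        -- property for `F'`.
        · have e : m ≫ i.app c.pt =
              hc'.lift ((Cone.postcompose (Functor.whiskerLeft K i)).obj s) := by
            refine hc'.uniq ((Cone.postcompose (Functor.whiskerLeft K i)).obj s) _ fun j => ?_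
            have e := hm j
            dsimp at e ⊢
            rw [Category.assoc, ← i.naturality, reassoc_of% e]
          rw [← e, Category.assoc, hr]
          exact (Category.comp_id m).symm⟩ }

theorem CategoryTheory.Limits.preservesColimitsOfShape_of_retract {J : Type*} [Category J]
    [PreservesColimitsOfShape J F'] : PreservesColimitsOfShape J F where
  preservesColimit {K} :=
    { preserves := fun {c} hc => ⟨by
        have hr : ∀ X, i.app X ≫ r.app X = 𝟙 _ := fun X => congr_app h X
        have hc' := isColimitOfPreserves F' hc
        -- Dually: extend along `r`, descend through the colimit cocone of `F'`, and precompose with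
        -- `i`.
        refine
          { desc := fun s => i.app c.pt ≫
              hc'.desc ((Cocone.precompose (Functor.whiskerLeft K r)).obj s)
            fac := fun s j => ?_
            uniq := fun s m hm => ?_ }
        · have e := hc'.fac ((Cocone.precompose (Functor.whiskerLeft K r)).obj s) j
          dsimp at e ⊢
          rw [i.naturality_assoc, e, ← Category.assoc, hr, Category.id_comp]
        · have e : r.app c.pt ≫ m =
              hc'.desc ((Cocone.precompose (Functor.whiskerLeft K r)).obj s) := by
            refine hc'.uniq ((Cocone.precompose (Functor.whiskerLeft K r)).obj s) _ fun j => ?_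
            have e := hm j
            dsimp at e ⊢
            rw [r.naturality_assoc, e]
          rw [← e, ← Category.assoc, hr]
          exact (Category.id_comp m).symm⟩ }

/-- A retract of an exact functor is exact. -/
theorem CategoryTheory.exactFunctor_of_retract (hF' : exactFunctor C D F') :
    exactFunctor C D F := by
  obtain ⟨h1, h2⟩ := hF'
  have h1 : PreservesFiniteLimits F' := h1
  have h2 : PreservesFiniteColimits F' := h2
  exact ⟨⟨fun _ => preservesLimitsOfShape_of_retract i r h⟩,
    ⟨fun _ => preservesColimitsOfShape_of_retract i r h⟩⟩

end Formal

namespace Equivariant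

open Algebra

variable {G : Type u} [Group G]

/-! ### The projection formula for finite `G`-sets -/

namespace BurnsideCat

theorem times_map_ofSpan {X Y Z W : FinGSet G} (S : GSpan X Y) (T : GSpan Z W) :
    (times G).map (X := (.of X, .of Z)) (Y := (.of Y, .of W))
      (ofSpan S, ofSpan T) = ofSpan (S.prod T) :=
  lift₂_of _ _ _

theorem times_map_sub_left {X Y Z W : BurnsideCat G} (f f' : X ⟶ Y) (g : Z ⟶ W) :
    (times G).map (X := (X, Z)) (Y := (Y, W)) (f - f', g) =
      (times G).map (X := (X, Z)) (Y := (Y, W)) (f, g) -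
        (times G).map (X := (X, Z)) (Y := (Y, W)) (f', g) :=
  DFunLike.congr_fun (map_sub (lift₂ SpanClass.prod) f f') g

theorem times_map_sub_right {X Y Z W : BurnsideCat G} (f : X ⟶ Y) (g g' : Z ⟶ W) :
    (times G).map (X := (X, Z)) (Y := (Y, W)) (f, g - g') =
      (times G).map (X := (X, Z)) (Y := (Y, W)) (f, g) -
        (times G).map (X := (X, Z)) (Y := (Y, W)) (f, g') :=
  map_sub (lift₂ SpanClass.prod f) g g'

end BurnsideCat

variable [Finite G] (H : Subgroup G)


section Projection

variable {H}

/-- The map `G ×_H (X × Y) → (G ×_H X) × Y`, `[g, (x, y)] ↦ ([g, x], g y)`. -/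
def projMap (X : FinGSet H) (Y : FinGSet G) : ind H (X.prod (res H Y)) →[G] (ind H X).prod Y where
  toFun z := (indMap (X := X.prod (res H Y)) (Y := X) ⟨fun p => p.1, fun _ _ => rfl⟩ z,
    indCounit Y (indMap (X := X.prod (res H Y)) (Y := res H Y) ⟨fun p => p.2, fun _ _ => rfl⟩ z))
  map_smul' g z := by
    refine Prod.ext ?_ ?_
    · exact map_smul (indMap _) g z
    · exact (congrArg (indCounit Y) (map_smul (indMap _) g z)).trans (map_smul (indCounit Y) g _)

/-- The inverse sends `([a, x], y)` to `[a, (x, a⁻¹ y)]`. -/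
theorem projMap_bijective (X : FinGSet H) (Y : FinGSet G) :
    Function.Bijective (projMap X Y) := by
  constructor
  · intro z z' h
    induction z using ind_rec with | _ a p
    induction z' using ind_rec with | _ b q
    obtain ⟨k, k1, k2⟩ := indMk_eq.1 (congrArg Prod.fst h)
    have k1' : a = b * (k : G) := k1
    have h2 : a • (show Y from p.2) = b • (show Y from q.2) := congrArg Prod.snd h
    rw [k1', mul_smul] at h2
    exact indMk_eq.2 ⟨k, k1, Prod.ext k2 (smul_left_cancel b h2).symm⟩
  · rintro ⟨z, y⟩
    induction z using ind_rec with | _ a x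
    exact ⟨indMk a ((x, (a⁻¹ • y : Y)) : X.prod (res H Y)),
      Prod.ext rfl (smul_inv_smul a y)⟩

/-- The map `φ` is left free, subject to `hφ`, so that either leg of a product span can be
substituted for it. -/
theorem projMap_naturality {X X' : FinGSet H} {Y Y' : FinGSet G} (f : X →[H] X') (g : Y →[G] Y')
    (φ : X.prod (res H Y) →[H] X'.prod (res H Y')) (hφ : ∀ p, φ p = (f p.1, g p.2))
    (z : ind H (X.prod (res H Y))) :
    projMap X' Y' (indMap φ z) = (indMap f (projMap X Y z).1, g (projMap X Y z).2) := by
  induction z using ind_rec with | _ a p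
  rw [indMap_mk, hφ]
  exact Prod.ext rfl (map_smul g a (show Y from p.2)).symm

/-- All the comparison maps are bijective, so the square required by `ofSpan_forward_eq` is
automatically cartesian. -/
theorem projMap_span {X X' : FinGSet H} {Y Y' : FinGSet G} (S : GSpan X X') (T : GSpan Y Y') :
    BurnsideCat.ofSpan (indSpan (S.prod (resSpan T))) ≫ BurnsideCat.forward (projMap X' Y') =
      BurnsideCat.forward (projMap X Y) ≫ BurnsideCat.ofSpan ((indSpan S).prod T) := by
  have hl := projMap_naturality S.left T.left (S.prod (resSpan T)).left (fun _ => rfl)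
  refine BurnsideCat.ofSpan_forward_eq (indSpan (S.prod (resSpan T))) ((indSpan S).prod T)
    (projMap X Y) (projMap X' Y') (projMap S.apex T.apex) (fun z => (hl z).symm)
    (fun z => (projMap_naturality S.right T.right (S.prod (resSpan T)).right (fun _ => rfl) z).symm)
    (fun _ _ _ h => (projMap_bijective _ _).1 h) (fun x b h => ?_)
  obtain ⟨z, hz⟩ := (projMap_bijective S.apex T.apex).2 b
  refine ⟨z, (projMap_bijective X Y).1 ?_, hz⟩
  rw [h, ← hz]
  exact hl z

/-- Both sides are additive in `f` and in `g`, which reduces the claim to the case of spans,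
`projMap_span`. -/
theorem projMap_natural {X X' : BurnsideCat H} {Y Y' : BurnsideCat G} (f : X ⟶ X') (g : Y ⟶ Y') :
    (indFunctor H).map ((BurnsideCat.times H).map (X := (X, (resFunctor H).obj Y))
        (Y := (X', (resFunctor H).obj Y')) (f, (resFunctor H).map g)) ≫
      BurnsideCat.forward (projMap X'.set Y'.set) =
    BurnsideCat.forward (projMap X.set Y.set) ≫
      (BurnsideCat.times G).map (X := ((indFunctor H).obj X, Y)) (Y := ((indFunctor H).obj X', Y'))
        ((indFunctor H).map f, g) := by
  induction f using BurnsideCat.hom_ind with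
  | ofSpan S =>
    induction g using BurnsideCat.hom_ind with
    | ofSpan T =>
      have h1 : (indFunctor H).map ((BurnsideCat.times H).map (X := (X, (resFunctor H).obj Y))
          (Y := (X', (resFunctor H).obj Y')) (BurnsideCat.ofSpan S,
            (resFunctor H).map (BurnsideCat.ofSpan T))) =
          BurnsideCat.ofSpan (indSpan (S.prod (resSpan T))) :=
        (congrArg (fun t => (indFunctor H).map ((BurnsideCat.times H).map
          (X := (X, (resFunctor H).obj Y)) (Y := (X', (resFunctor H).obj Y'))
          (BurnsideCat.ofSpan S, t))) (resFunctor_map_ofSpan T)).trans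
          ((congrArg (fun t => (indFunctor H).map t)
            (BurnsideCat.times_map_ofSpan S (resSpan T))).trans (indFunctor_map_ofSpan _))
      have h2 : (BurnsideCat.times G).map (X := ((indFunctor H).obj X, Y))
          (Y := ((indFunctor H).obj X', Y')) ((indFunctor H).map (BurnsideCat.ofSpan S),
            BurnsideCat.ofSpan T) = BurnsideCat.ofSpan ((indSpan S).prod T) :=
        (congrArg (fun t => (BurnsideCat.times G).map (X := ((indFunctor H).obj X, Y))
          (Y := ((indFunctor H).obj X', Y')) (t, BurnsideCat.ofSpan T))
          (indFunctor_map_ofSpan S)).trans (BurnsideCat.times_map_ofSpan (indSpan S) T)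
      exact (congrArg (fun t => t ≫ BurnsideCat.forward (projMap X'.set Y'.set)) h1).trans
        ((projMap_span S T).trans
          (congrArg (fun t => BurnsideCat.forward (projMap X.set Y.set) ≫ t) h2.symm))
    | sub g g' hg hg' =>
      rw [Functor.map_sub, BurnsideCat.times_map_sub_right, BurnsideCat.times_map_sub_right,
        Functor.map_sub]
      exact (Preadditive.sub_comp _ _ _).trans
        ((congrArg₂ (fun s t => s - t) hg hg').trans (Preadditive.comp_sub _ _ _).symm)
  | sub f f' hf hf' =>
    rw [Functor.map_sub, BurnsideCat.times_map_sub_left, BurnsideCat.times_map_sub_left,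
      Functor.map_sub]
    exact (Preadditive.sub_comp _ _ _).trans
      ((congrArg₂ (fun s t => s - t) hf hf').trans (Preadditive.comp_sub _ _ _).symm)

end Projection

/-- The projection formula `G ×_H (X × Y) ≅ (G ×_H X) × Y` in the Burnside category. -/
def projIso : ((𝟭 (BurnsideCat H)).prod (resFunctor H) ⋙ BurnsideCat.times H) ⋙ indFunctor H ≅
    (indFunctor H).prod (𝟭 (BurnsideCat G)) ⋙ BurnsideCat.times G :=
  NatIso.ofComponents
    -- The forward direction of this isomorphism unfolds to `forward (projMap ..)`, the map in
    -- `projMap_natural`.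
    (fun P => isoOfEquiv (Equiv.ofBijective _ (projMap_bijective P.1.set P.2.set))
      (map_smul (projMap P.1.set P.2.set)))
    (fun f => projMap_natural f.1 f.2)

/-! ### The external product -/

/-- The external tensor product with `M`, for functors on possibly different categories. -/
def externalProd {C D : Type*} [Category C] [Category D] (M : D ⥤ AddCommGrpCat.{w}) :
    (C ⥤ AddCommGrpCat.{w}) ⥤ (C × D ⥤ AddCommGrpCat.{w}) where
  obj N := N.prod M ⋙ tensorAb
  map α := Functor.whiskerRight (NatTrans.prod α (𝟙 M)) tensorAb
  map_id N := NatTrans.ext (funext fun P => tensorAb.map_id (N.obj P.1, M.obj P.2))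
  map_comp {N N' N''} α β := NatTrans.ext (funext fun P => by
    have h := tensorAb.map_comp (X := (N.obj P.1, M.obj P.2)) (Y := (N'.obj P.1, M.obj P.2))
      (Z := (N''.obj P.1, M.obj P.2)) (α.app P.1, 𝟙 _) (β.app P.1, 𝟙 _)
    rw [prod_comp, Category.comp_id] at h
    exact h)

/-- Restriction of functors along `F`. -/
abbrev pre {C D : Type*} [Category C] [Category D] (F : C ⥤ D) :
    (D ⥤ AddCommGrpCat.{w}) ⥤ (C ⥤ AddCommGrpCat.{w}) :=
  (Functor.whiskeringLeft C D AddCommGrpCat.{w}).obj F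

/-- Both sides are left adjoint to restriction along the functor of the projection formula. -/
def lanProjIso :
    pre.{w} ((𝟭 (BurnsideCat H)).prod (indFunctor H)) ⋙ (BurnsideCat.times H).lan ⋙
      pre (resFunctor H) ≅
    pre ((resFunctor H).prod (𝟭 (BurnsideCat G))) ⋙ (BurnsideCat.times G).lan :=
  -- Precomposition reverses adjunctions: `F ⊣ R` makes `pre R` left adjoint to `pre F`. The first
  -- composite thus has as right adjoint precomposition with `(X, Y) ↦ Ind (X × Res Y)`, which
  -- `projIso` replaces by `(X, Y) ↦ Ind X × Y`.
  (((((Adjunction.id.prodAdj (resIndAdj H)).whiskerLeft _).comp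
    (((BurnsideCat.times H).lanAdjunction _).comp ((indResAdj H).whiskerLeft _)))).ofNatIsoRight
      ((Functor.whiskeringLeft _ _ _).mapIso (projIso H))).leftAdjointUniq
    -- The second composite is left adjoint to precomposition with `(X, Y) ↦ Ind X × Y` directly,
    -- and left adjoints are unique.
    ((((indResAdj H).prodAdj Adjunction.id).whiskerLeft _).comp
      ((BurnsideCat.times G).lanAdjunction _))

/-! ### Induction of Mackey functors -/

/-- The induction of a Mackey functor for `H`. -/
def induction : Mackey.{u, w} H ⥤ Mackey.{u, w} G :=
  ObjectProperty.lift _ (AdditiveFunctor.forget _ _ ⋙ pre (resFunctor H))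
    (fun M => inferInstanceAs (resFunctor H ⋙ M.obj).Additive)

/-- Induction of Mackey functors is left adjoint to restriction. -/
def inductionAdj : induction.{u, w} H ⊣ restriction H :=
  -- The adjunction holds between categories of all functors. It restricts to additive ones because
  -- both precompositions preserve additivity.
  ((indResAdj H).whiskerLeft AddCommGrpCat.{w}).restrictFullyFaithful
    (ObjectProperty.fullyFaithfulι _) (ObjectProperty.fullyFaithfulι _) (Iso.refl _) (Iso.refl _)

/-- Induction of Mackey functors is right adjoint to restriction. -/
def restrictionAdj : restriction.{u, w} H ⊣ induction H :=
  ((resIndAdj H).whiskerLeft AddCommGrpCat.{w}).restrictFullyFaithful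
    (ObjectProperty.fullyFaithfulι _) (ObjectProperty.fullyFaithfulι _) (Iso.refl _) (Iso.refl _)

/-- `Ind (N ⊠ i_H^* M) ≅ Ind N ⊠ M`. -/
def boxRightInductionIso (M : Mackey.{u, w} G) :
    boxRight ((restriction H).obj M) ⋙ induction H ≅ induction H ⋙ boxRight M :=
  -- Evaluate `lanProjIso` on `(X, Y) ↦ N X ⊗ M Y`, with `N` over `H` and `M` over `G`. Precomposing
  -- with `𝟭 × Ind` gives the external product of `N` and `i_H^* M`, and with `Res × 𝟭` that of `Ind
  -- N` and `M`. The isomorphism of underlying functors then lifts to Mackey functors by full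
  -- faithfulness.
  ((ObjectProperty.fullyFaithfulι _).whiskeringRight _).preimageIso
    (Functor.isoWhiskerLeft (AdditiveFunctor.forget _ _ ⋙ externalProd M.obj) (lanProjIso H))

/-- The natural map `N ⟶ i_H^* Ind N`. -/
def toRestrictionInduction : 𝟭 (Mackey.{u, w} H) ⟶ induction H ⋙ restriction H where
  app N := ObjectProperty.homMk (Functor.whiskerRight (unitForward H) N.obj)
  naturality _ _ f := ObjectProperty.hom_ext _ (NatTrans.ext (funext fun X =>
    (f.hom.naturality ((unitForward H).app X)).symm))

/-- The natural map `i_H^* Ind N ⟶ N`. -/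
def ofRestrictionInduction : induction H ⋙ restriction H ⟶ 𝟭 (Mackey.{u, w} H) where
  app N := ObjectProperty.homMk (Functor.whiskerRight (unitBackward H) N.obj)
  naturality _ _ f := ObjectProperty.hom_ext _ (NatTrans.ext (funext fun X =>
    (f.hom.naturality ((unitBackward H).app X)).symm))

/-- `N` applied to `unitForward_unitBackward`. -/
theorem toRestrictionInduction_ofRestrictionInduction :
    toRestrictionInduction.{u, w} H ≫ ofRestrictionInduction H = 𝟙 _ :=
  NatTrans.ext (funext fun N => ObjectProperty.hom_ext _ (NatTrans.ext (funext fun X =>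
    (N.obj.map_comp _ _).symm.trans
      ((congrArg (fun t => N.obj.map t) (congr_app (unitForward_unitBackward H) X)).trans
        (N.obj.map_id X)))))

/-- The restriction of a flat Mackey functor is flat. -/
theorem isFlat_restriction (M : Mackey.{u, w} G) (hM : IsFlat M) :
    IsFlat ((restriction H).obj M) := by
  have h1 : PreservesFiniteLimits (boxRight M) := hM.1
  have h2 : PreservesFiniteColimits (boxRight M) := hM.2
  -- Each of the two functors is a left and a right adjoint; size zero already covers all finite
  -- diagrams.
  have : PreservesLimitsOfSize.{0, 0} (restriction.{u, w} H) :=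
    (inductionAdj H).rightAdjoint_preservesLimits
  have : PreservesColimitsOfSize.{0, 0} (induction.{u, w} H) :=
    (inductionAdj H).leftAdjoint_preservesColimits
  have : PreservesLimitsOfSize.{0, 0} (induction.{u, w} H) :=
    (restrictionAdj H).rightAdjoint_preservesLimits
  have : PreservesColimitsOfSize.{0, 0} (restriction.{u, w} H) :=
    (restrictionAdj H).leftAdjoint_preservesColimits
  -- By the projection formula this composite is induction, then `- ⊠ M`, then restriction; flatness
  -- of `M` enters here.
  have hT : exactFunctor _ _
      ((boxRight ((restriction H).obj M) ⋙ induction H) ⋙ restriction H) := by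
    refine (exactFunctor _ _).prop_of_iso
      (Functor.isoWhiskerRight (boxRightInductionIso H M).symm (restriction H)) ⟨?_, ?_⟩
    · have : PreservesFiniteLimits (induction.{u, w} H) := inferInstance
      have : PreservesFiniteLimits (restriction.{u, w} H) := inferInstance
      exact comp_preservesFiniteLimits _ _
    · have : PreservesFiniteColimits (induction.{u, w} H) := inferInstance
      have : PreservesFiniteColimits (restriction.{u, w} H) := inferInstance
      exact comp_preservesFiniteColimits _ _
  -- The retraction of `N` off `i_H^* Ind N`, evaluated at `N ⊠ i_H^* M`.
  refine exactFunctor_of_retract (F' := (boxRight ((restriction H).obj M) ⋙ induction H) ⋙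
    restriction H) (Functor.whiskerLeft (boxRight ((restriction H).obj M))
      (toRestrictionInduction H)) (Functor.whiskerLeft (boxRight ((restriction H).obj M))
      (ofRestrictionInduction H)) ?_ hT
  exact (Functor.whiskerLeft_comp _ _ _).symm.trans
    ((congrArg (Functor.whiskerLeft _) (toRestrictionInduction_ofRestrictionInduction H)).trans
      (Functor.whiskerLeft_id' _))

end Equivariant

end

theorem mainTheorem10 {G : Type u} [Group G] [Finite G] (H : Subgroup G)
    (M : Equivariant.Mackey.{u, w} G) (hM : Equivariant.IsFlat M) :
    Equivariant.IsFlat ((Equivariant.restriction H).obj M) :=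
  Equivariant.isFlat_restriction H M hM
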